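/- For each $k\in\mathbb N$ let $n_k,d_k$ be natural numbers, let $\mathcal X_k$ be a measurable space, let $Q_k$ be a probability measure on $\mathcal X_k$, and let $P_k$ be a probability measure on $\mathcal X_k\times\mathcal X_k$ with both marginals equal to $Q_k$ and $P_k\ll Q_k\times Q_k$. Assume that the likelihood $\mathcal L_k=\frac{dP_k}{d(Q_k\times Q_k)}$ is symmetric, $\mathcal L_k(x,y)=\mathcal L_k(y,x)$, and square-integrable under $Q_k\times Q_k$. Let $\lambda_0,\lambda_1,\dots$ (depending on $k$) be the eigenvalues, with multiplicity and in decreasing order of absolute value (continued by zeros if only finitely many are nonzero), of the self-adjoint Hilbert–Schmidt operator $(\mathcal L_kf)(x)=\mathbb E_{Y\sim Q_k}[\mathcal L_k(x,Y)f(Y)]$ on $L^2(Q_k)$; then $|\lambda_0|=1$. One observes two databases $\mathsf X=(X_1,\dots,X_n)$, $\mathsf Y=(Y_1,\dots,Y_n)$ with $X_i,Y_i\in\mathcal X_k^{d}$, where $n=n_k$, $d=d_k$. Under $\mathcal H_0$ all the $X_i$ and $Y_i$ are independent with law $Q_k^{\otimes d}$. Under $\mathcal H_1$, given a permutation $\sigma\in\mathbb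 S_n$, the pairs $(X_1,Y_{\sigma_1}),\dots,(X_n,Y_{\sigma_n})$ are i.i.d. with law $P_k^{\otimes d}$ (this law of $(\mathsf X,\mathsf Y)$ is $\mathbb P_{\mathcal H_1|\sigma}$). Let $$\mathsf R^\star_k=\inf_{\phi}\Big(\mathbb P_{\mathcal H_0}[\phi(\mathsf X,\mathsf Y)=1]+\max_{\sigma\in\mathbb S_n}\mathbb P_{\mathcal H_1|\sigma}[\phi(\mathsf X,\mathsf Y)=0]\Big),$$ where $\phi$ ranges over all measurable $\{0,1\}$-valued tests. The sequence is admissible for strong detection if $\lim_{k\to\infty}\mathsf R^\star_k=0$. Let $\mathsf L_n=\frac{d\mathbb P_{\mathcal H_1}}{d\mathbb P_{\mathcal H_0}}$ with $\mathbb P_{\mathcal H_1}=\frac1{n!}\sum_{\sigma\in\mathbb S_n}\mathbb P_{\mathcal H_1|\sigma}$. Theorem (Strong detection lower bounds). In each of the following three cases $\mathbb E_{\mathcal H_0}[\mathsf L_n^2]$ is bounded uniformly in $k$, and the sequence is not admissible for strong detection: (i) $d$ and the $\lambda_i$, $i\ge1$, do not depend on $k$, $n\to\infty$, and $$d<-\frac{\log\lambda_1^2}{\log\sum_{i\ge0}\lambda_i^2}$$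 (the right-hand side being read as $+\infty$ if $\lambda_1=0$); (ii) $n\to\infty$, $d\to\infty$, and for some $\varepsilon>0$ independent of $k$, for all sufficiently large $k$, $$\sum_{i\ge1}\frac{\lambda_i^2}{1-\lambda_i^2}<\frac{1-\varepsilon}{d};$$ (iii) $n$ does not depend on $k$, $d\to\infty$, and $\sum_{i\ge1}\frac{\lambda_i^2}{1-\lambda_i^2}=O(1/d)$. In (ii) and (iii) the sum is $+\infty$ if it diverges or if $\lambda_i^2=1$ for some $i\ge1$. -/

import Mathlib

open MeasureTheory Filter Topology
open scoped ENNReal NNReal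

/-- The pair of single-letter distributions of the testing problem, with the standing
assumptions: `P` (that is `P_XY`) is a probability measure on `𝒳 × 𝒳` with both marginals equal
to `Q` (that is `P_X = P_Y`), it has a likelihood function (a density) with respect to the product
`Q_XY = Q × Q`, and this likelihood function is symmetric and square-integrable. -/
structure DatabasePair (𝒳 : Type*) [MeasurableSpace 𝒳] where
  /-- the common marginal `P_X = P_Y` -/
  Q : Measure 𝒳
  /-- the joint law `P_XY` -/
  P : Measure (𝒳 × 𝒳)
  isProbabilityMeasure_Q : IsProbabilityMeasure Q
  fst_eq : P.map Prod.fst = Q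
  snd_eq : P.map Prod.snd = Q
  absolutelyContinuous : P ≪ Q.prod Q
  symmetric : ∀ᵐ p ∂(Q.prod Q), P.rnDeriv (Q.prod Q) p.swap = P.rnDeriv (Q.prod Q) p
  square_integrable : ∫⁻ p, P.rnDeriv (Q.prod Q) p ^ 2 ∂(Q.prod Q) < ∞

namespace DatabasePair

variable {𝒳 : Type*} [MeasurableSpace 𝒳]

/-- The single-letter likelihood function `ℒ(x,y) = (dP_XY / dQ_XY)(x,y)`, as a real number. -/
noncomputable def likelihood (D : DatabasePair 𝒳) (x y : 𝒳) : ℝ :=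
  (D.P.rnDeriv (D.Q.prod D.Q) (x, y)).toReal

/-- The `μ`-eigenspace in `L²(Q)` of the operator `(ℒ f)(x) = 𝔼_{Y ∼ Q}[ℒ(x,Y) f(Y)]`. (Since `ℒ`
is square-integrable, the integrability clause holds for every `f ∈ L²(Q)`; it is there so that
the integral is never a default value.) -/
noncomputable def eigenspace (D : DatabasePair 𝒳) (μ : ℝ) : Submodule ℝ (Lp ℝ 2 D.Q) where
  carrier := {f | (∀ᵐ x ∂D.Q, Integrable (fun y => D.likelihood x y * f y) D.Q) ∧
    ∀ᵐ x ∂D.Q, ∫ y, D.likelihood x y * f y ∂D.Q = μ * f x}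
  zero_mem' := by
    have h0 := Lp.coeFn_zero ℝ 2 D.Q
    have h1 : ∀ x, (fun y => D.likelihood x y * (0 : Lp ℝ 2 D.Q) y) =ᵐ[D.Q] fun _ => 0 := by
      intro x
      filter_upwards [h0] with y hy
      rw [hy, Pi.zero_apply, mul_zero]
    refine ⟨Eventually.of_forall fun x => (integrable_zero _ _ _).congr (h1 x).symm, ?_⟩
    filter_upwards [h0] with x hx
    rw [integral_congr_ae (h1 x), hx]
    simp
  add_mem' := by
    rintro f g ⟨hf, hf'⟩ ⟨hg, hg'⟩
    have h0 := Lp.coeFn_add f g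
    have h1 : ∀ x, (fun y => D.likelihood x y * (f + g : Lp ℝ 2 D.Q) y) =ᵐ[D.Q]
        fun y => D.likelihood x y * f y + D.likelihood x y * g y := by
      intro x
      filter_upwards [h0] with y hy
      rw [hy, Pi.add_apply, mul_add]
    refine ⟨?_, ?_⟩
    · filter_upwards [hf, hg] with x hfx hgx
      exact (hfx.add hgx).congr (h1 x).symm
    · filter_upwards [hf, hg, hf', hg', h0] with x hfx hgx hfx' hgx' hx
      rw [integral_congr_ae (h1 x), integral_add hfx hgx, hfx', hgx', hx]
      simp [mul_add]
  smul_mem' := by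
    rintro c f ⟨hf, hf'⟩
    have h0 := Lp.coeFn_smul c f
    have h1 : ∀ x, (fun y => D.likelihood x y * (c • f : Lp ℝ 2 D.Q) y) =ᵐ[D.Q]
        fun y => c * (D.likelihood x y * f y) := by
      intro x
      filter_upwards [h0] with y hy
      rw [hy, Pi.smul_apply, smul_eq_mul, mul_left_comm]
    refine ⟨?_, ?_⟩
    · filter_upwards [hf] with x hfx
      exact (hfx.const_mul c).congr (h1 x).symm
    · filter_upwards [hf', h0] with x hfx' hx
      rw [integral_congr_ae (h1 x), integral_const_mul, hfx', hx]
      simp [mul_left_comm]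

/-- `lam 0, lam 1, …` is the sequence of eigenvalues of the operator `ℒ` on `L²(Q)`, in decreasing
order of absolute value: each nonzero real number occurs in it as often as its multiplicity as an
eigenvalue. (If there are only finitely many nonzero eigenvalues, the sequence is continued by
zeros.) -/
def IsEigenvalueSeq (D : DatabasePair 𝒳) (lam : ℕ → ℝ) : Prop :=
  Antitone (fun i => |lam i|) ∧
    ∀ μ : ℝ, μ ≠ 0 → {i | lam i = μ}.encard = Cardinal.toENat (Module.rank ℝ (D.eigenspace μ))

/-- The space of two databases `(X, Y)`, each an `n × d` matrix with entries in `𝒳`. -/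
abbrev Data (𝒳 : Type*) (n d : ℕ) : Type _ := (Fin n → Fin d → 𝒳) × (Fin n → Fin d → 𝒳)

/-- The null distribution: all entries of `X` and `Y` are independent with law `Q`. -/
noncomputable def null (D : DatabasePair 𝒳) (n d : ℕ) : Measure (Data 𝒳 n d) :=
  (Measure.pi fun _ : Fin n => Measure.pi fun _ : Fin d => D.Q).prod
    (Measure.pi fun _ : Fin n => Measure.pi fun _ : Fin d => D.Q)

/-- The alternative distribution given `σ`: the pairs `(X_i, Y_{σ i})`, `i = 1, …, n`, are
independent with law `P_XY^{⊗ d}`. It is the law of `(X, Y)` with `X_i = (w_i)₁` and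
`Y_{σ i} = (w_i)₂` for `w_1, …, w_n` independent with law `P_XY^{⊗ d}`. -/
noncomputable def alt (D : DatabasePair 𝒳) (n d : ℕ) (σ : Equiv.Perm (Fin n)) :
    Measure (Data 𝒳 n d) :=
  (Measure.pi fun _ : Fin n => Measure.pi fun _ : Fin d => D.P).map
    fun w => (fun i j => (w i j).1, fun l j => (w (σ.symm l) j).2)

/-- The mixture of the alternative distributions over a uniformly random permutation. -/
noncomputable def mixture (D : DatabasePair 𝒳) (n d : ℕ) : Measure (Data 𝒳 n d) :=
  (Fintype.card (Equiv.Perm (Fin n)) : ℝ≥0∞)⁻¹ • ∑ σ : Equiv.Perm (Fin n), D.alt n d σ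

/-- The second moment `𝔼_{H₀}[L_n²]` of the likelihood ratio `L_n = dℙ_{H₁} / dℙ_{H₀}`. -/
noncomputable def secondMoment (D : DatabasePair 𝒳) (n d : ℕ) : ℝ≥0∞ :=
  ∫⁻ z, (D.mixture n d).rnDeriv (D.null n d) z ^ 2 ∂(D.null n d)

/-- The risk of a test: the type-I error plus the worst-case type-II error. -/
noncomputable def risk (D : DatabasePair 𝒳) (n d : ℕ) (φ : Data 𝒳 n d → Fin 2) : ℝ≥0∞ :=
  D.null n d {z | φ z = 1} + ⨆ σ : Equiv.Perm (Fin n), D.alt n d σ {z | φ z = 0}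

/-- The minimax risk, the infimum being over all (measurable) tests. -/
noncomputable def minimaxRisk (D : DatabasePair 𝒳) (n d : ℕ) : ℝ≥0∞ :=
  ⨅ (φ : Data 𝒳 n d → Fin 2) (_ : Measurable φ), D.risk n d φ

end DatabasePair

/-- A sequence `(D_k, d_k, n_k)` is admissible for strong detection if its minimax risk tends
to zero. -/
def AdmissibleStrong {𝒳 : ℕ → Type*} [∀ k, MeasurableSpace (𝒳 k)]
    (D : ∀ k, DatabasePair (𝒳 k)) (d n : ℕ → ℕ) : Prop :=
  Tendsto (fun k => (D k).minimaxRisk (n k) (d k)) atTop (𝓝 0)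

/-- `∑_{i ≥ 1} λ_i² / (1 - λ_i²)`, with value `∞` if the series diverges or if `λ_i² = 1` for some
`i ≥ 1`. -/
noncomputable def eigenvalueSum (lam : ℕ → ℝ) : ℝ≥0∞ :=
  ∑' i : ℕ, ENNReal.ofReal (lam (i + 1) ^ 2) / ENNReal.ofReal (1 - lam (i + 1) ^ 2)

/-!
The second moment can be bounded by a symmetric function of the squared eigenvalues. Write the
likelihood of a row, a kernel on `𝒳 ^ d`, in its eigenfunctions: its eigenvalues are the products
`λ_m = ∏ j, λ_{m j}` over words `m ∈ ℕ ^ d`. Averaging the likelihood ratios of the alternatives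
over `σ` projects the `n`-fold tensor power of this kernel onto symmetric tensors, so that
`𝔼[L_n²]` is the complete homogeneous symmetric polynomial of degree `n` in the numbers `λ_m²`.
Since `|λ_0| ≤ 1`, this is at most `∏_{m ≠ 0} (1 - λ_m²)⁻¹`, uniformly in `n`, and hence at most
`exp ((1 + S) ^ d / (1 - λ_1²))` with `S = ∑_{i ≥ 1} λ_i²`. This is
`DatabasePair.secondMoment_le_exp`, and in each of the three regimes its right-hand side is bounded.

Two simplifications make the argument elementary. Only an upper bound is needed, so the
eigenfunction expansion of the likelihood (`exists_kernel_eigenexpansion`) is truncated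
and Fatou's lemma is applied along an almost everywhere convergent subsequence
(`DatabasePair.secondMoment_le_of_truncations`). For a truncation, orthonormality turns the second
moment into `1 / n!` times the weighted number of pairs of a word and a permutation fixing it
(`integral_finiteRankRatio_sq`), and instead of counting orbits one injects the pairs with given
letter counts into the permutations (`card_word_stabilizer_le`).

The expansion itself rests on the compactness of Hilbert–Schmidt operators
(`isCompactOperator_kernelOp`) and the spectral theorem. Finally a bounded second moment forces a
set of small null probability to have small probability under the mixture, which bounds the risk of
every test from below (`DatabasePair.le_minimaxRisk`).
-/

/-! ### Permutations fixing a word, and multisets of letters -/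

section Words

variable {α : Type*} [DecidableEq α]

/-- The number of occurrences of the letter `m` in the word `a`. -/
def letterCount {n : ℕ} (a : Fin n → α) (m : α) : ℕ :=
  (Finset.univ.filter fun i => a i = m).card

theorem exists_perm_of_letterCount_eq {n : ℕ} {a b : Fin n → α}
    (h : letterCount a = letterCount b) : ∃ τ : Equiv.Perm (Fin n), b = a ∘ τ := by
  have e : ∀ m, Nonempty ({i // b i = m} ≃ {i // a i = m}) := fun m => by
    refine ⟨Fintype.equivOfCardEq ?_⟩
    rw [Fintype.card_subtype, Fintype.card_subtype]
    exact (congrFun h m).symm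
  refine ⟨(Equiv.sigmaFiberEquiv b).symm.trans
    ((Equiv.sigmaCongrRight fun m => (e m).some).trans (Equiv.sigmaFiberEquiv a)), ?_⟩
  funext i
  simp only [Function.comp, Equiv.trans_apply]
  exact (((e (b i)).some ⟨i, rfl⟩).2).symm

variable [Fintype α]

theorem sum_letterCount {n : ℕ} (a : Fin n → α) : ∑ m, letterCount a m = n := by
  have := Finset.card_eq_sum_card_fiberwise (f := a) (s := Finset.univ) (t := Finset.univ)
    (fun _ _ => by simp)
  simpa [letterCount] using this.symm

theorem prod_word_eq_prod_pow {n : ℕ} (Λ : α → ℝ) (a : Fin n → α) :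
    ∏ i, Λ (a i) = ∏ m, Λ m ^ letterCount a m := by
  rw [← Finset.prod_fiberwise Finset.univ a]
  refine Finset.prod_congr rfl fun m _ => ?_
  rw [Finset.prod_congr rfl (g := fun _ => Λ m), Finset.prod_const]
  · rfl
  · intro i hi
    rw [(Finset.mem_filter.1 hi).2]

/-- The words with prescribed letter counts, each taken together with a permutation fixing it,
are at most `n!` in number: a pair `(a₀ ∘ τ_a, σ)` is determined by the permutation `τ_a σ`. -/
theorem card_word_stabilizer_le {n : ℕ} (k : α → ℕ) :
    ∑ a : Fin n → α with letterCount a = k,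
      (Finset.univ.filter fun σ : Equiv.Perm (Fin n) => a ∘ σ = a).card ≤ n.factorial := by
  classical
  rcases (Finset.univ.filter fun a : Fin n → α => letterCount a = k).eq_empty_or_nonempty with
    h | ⟨a₀, ha₀⟩
  · rw [h]; simp
  have ha₀ : letterCount a₀ = k := (Finset.mem_filter.1 ha₀).2
  have hτ : ∀ a : Fin n → α, ∃ τ : Equiv.Perm (Fin n), letterCount a = k → a = a₀ ∘ τ := by
    intro a
    by_cases h : letterCount a = k
    · obtain ⟨τ, hτ⟩ := exists_perm_of_letterCount_eq (ha₀.trans h.symm)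
      exact ⟨τ, fun _ => hτ⟩
    · exact ⟨1, fun h' => absurd h' h⟩
  choose τ hτ using hτ
  rw [← Finset.card_sigma]
  calc _ ≤ (Finset.univ : Finset (Equiv.Perm (Fin n))).card := by
        refine Finset.card_le_card_of_injOn (fun p => p.2.trans (τ p.1)) (fun _ _ => by simp) ?_
        have key : ∀ p ∈ (Finset.univ.filter fun a : Fin n → α => letterCount a = k).sigma
            (fun a => Finset.univ.filter fun σ : Equiv.Perm (Fin n) => a ∘ σ = a),
            p.1 = a₀ ∘ (p.2.trans (τ p.1)) := by
          rintro ⟨a, σ⟩ hp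
          simp only [Finset.mem_sigma, Finset.mem_filter, Finset.mem_univ, true_and] at hp
          show a = (a₀ ∘ τ a) ∘ σ
          rw [← hτ a hp.1, hp.2]
        rintro ⟨a, σ⟩ hp ⟨b, ρ⟩ hq h
        have h1 := key _ hp
        have h2 := key _ hq
        dsimp only at h h1 h2
        rw [h, ← h2] at h1
        subst h1
        have : σ = ρ := by
          ext i
          have := congrArg (fun e : Equiv.Perm (Fin n) => (τ a).symm (e i)) h
          simpa using congrArg Fin.val this
        rw [this]
    _ = n.factorial := by
        rw [Finset.card_univ, Fintype.card_perm, Fintype.card_fin]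

/-- The average over permutations of the weight of the words they fix is at most the complete
homogeneous symmetric polynomial of degree `n` of the weights; leaving out one letter of weight at
most one, the latter is bounded by a product of geometric series. -/
theorem sum_word_stabilizer_le (n : ℕ) (Λ : α → ℝ) (h0 : ∀ m, 0 ≤ Λ m) (h1 : ∀ m, Λ m ≤ 1)
    (B : Finset α) (hB : ∀ m ∈ B, Λ m < 1) (hBc : ∀ m ∉ B, ∀ m' ∉ B, m = m') :
    ∑ a : Fin n → α, (∏ i, Λ (a i)) *
      ((Finset.univ.filter fun σ : Equiv.Perm (Fin n) => a ∘ σ = a).card : ℝ)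
      ≤ n.factorial * ∏ m ∈ B, (1 - Λ m)⁻¹ := by
  classical
  set I : Finset (α → ℕ) := Finset.univ.image (fun a : Fin n → α => letterCount a) with hI
  have step1 : ∑ a : Fin n → α, (∏ i, Λ (a i)) *
      ((Finset.univ.filter fun σ : Equiv.Perm (Fin n) => a ∘ σ = a).card : ℝ)
      ≤ ∑ k ∈ I, n.factorial * ∏ m, Λ m ^ k m := by
    rw [← Finset.sum_fiberwise_of_maps_to (s := Finset.univ) (t := I)
      (g := fun a : Fin n → α => letterCount a) (fun a _ => Finset.mem_image_of_mem _ (by simp))]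
    refine Finset.sum_le_sum fun k _ => ?_
    have : ∀ a ∈ Finset.univ.filter (fun a : Fin n → α => letterCount a = k),
        (∏ i, Λ (a i)) *
          ((Finset.univ.filter fun σ : Equiv.Perm (Fin n) => a ∘ σ = a).card : ℝ)
        = (∏ m, Λ m ^ k m) *
          ((Finset.univ.filter fun σ : Equiv.Perm (Fin n) => a ∘ σ = a).card : ℝ) := by
      intro a ha
      rw [prod_word_eq_prod_pow, (Finset.mem_filter.1 ha).2]
    rw [Finset.sum_congr rfl this, ← Finset.mul_sum, mul_comm]
    refine mul_le_mul_of_nonneg_right ?_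
      (Finset.prod_nonneg fun m _ => pow_nonneg (h0 m) _)
    exact_mod_cast card_word_stabilizer_le k
  have step2 : ∑ k ∈ I, ∏ m, Λ m ^ k m ≤ ∏ m ∈ B, (1 - Λ m)⁻¹ := by
    set t : α → Finset ℕ := fun m => if m ∈ B then Finset.range (n + 1) else {0} with ht
    set r : (α → ℕ) → α → ℕ := fun k m => if m ∈ B then k m else 0 with hr
    have hsum : ∀ k ∈ I, ∑ m, k m = n := by
      intro k hk
      obtain ⟨a, -, rfl⟩ := Finset.mem_image.1 hk
      exact sum_letterCount a
    -- the count of the letter outside `B` is recovered from the total count `n`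
    have hinj : Set.InjOn r I := by
      intro k hk k' hk' h
      have hin : ∀ m ∈ B, k m = k' m := fun m hm => by
        have := congrFun h m
        simpa [hr, hm] using this
      funext m
      by_cases hm : m ∈ B
      · exact hin m hm
      have e1 := (hsum k hk).trans (hsum k' hk').symm
      rw [← Finset.add_sum_erase _ _ (Finset.mem_univ m),
        ← Finset.add_sum_erase _ k' (Finset.mem_univ m)] at e1
      have e2 : ∑ x ∈ Finset.univ.erase m, k x = ∑ x ∈ Finset.univ.erase m, k' x := by
        refine Finset.sum_congr rfl fun x hx => ?_
        by_cases hxB : x ∈ B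
        · exact hin x hxB
        · exact absurd (hBc x hxB m hm) (Finset.ne_of_mem_erase hx)
      omega
    have hmaps : ∀ k ∈ I, r k ∈ Fintype.piFinset t := by
      intro k hk
      rw [Fintype.mem_piFinset]
      intro m
      by_cases hm : m ∈ B
      · simp only [hr, ht, hm, if_true, Finset.mem_range]
        have := Finset.single_le_sum (f := k) (fun _ _ => Nat.zero_le _) (Finset.mem_univ m)
        rw [hsum k hk] at this
        omega
      · simp [hr, ht, hm]
    calc ∑ k ∈ I, ∏ m, Λ m ^ k m ≤ ∑ k ∈ I, ∏ m, Λ m ^ (r k) m := by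
          refine Finset.sum_le_sum fun k _ => Finset.prod_le_prod
            (fun m _ => pow_nonneg (h0 m) _) fun m _ => ?_
          by_cases hm : m ∈ B
          · simp [hr, hm]
          · simpa [hr, hm] using pow_le_one₀ (h0 m) (h1 m)
      _ = ∑ k ∈ I.image r, ∏ m, Λ m ^ k m := by rw [Finset.sum_image hinj]
      _ ≤ ∑ k ∈ Fintype.piFinset t, ∏ m, Λ m ^ k m := by
          refine Finset.sum_le_sum_of_subset_of_nonneg ?_
            fun k _ _ => Finset.prod_nonneg fun m _ => pow_nonneg (h0 m) _
          intro k hk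
          obtain ⟨k', hk', rfl⟩ := Finset.mem_image.1 hk
          exact hmaps k' hk'
      _ = ∏ m, ∑ j ∈ t m, Λ m ^ j := (Finset.prod_univ_sum t fun m j => Λ m ^ j).symm
      _ = ∏ m ∈ B, ∑ j ∈ Finset.range (n + 1), Λ m ^ j := by
          rw [← Finset.prod_subset (Finset.subset_univ B)]
          · exact Finset.prod_congr rfl fun m hm => by simp [ht, hm]
          · intro m _ hm
            simp [ht, hm]
      _ ≤ ∏ m ∈ B, (1 - Λ m)⁻¹ := by
          refine Finset.prod_le_prod
            (fun m _ => Finset.sum_nonneg fun j _ => pow_nonneg (h0 m) _) fun m hm => ?_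
          rw [← tsum_geometric_of_lt_one (h0 m) (hB m hm)]
          exact (summable_geometric_of_lt_one (h0 m) (hB m hm)).sum_le_tsum _
            fun j _ => pow_nonneg (h0 m) _
  rw [← Finset.mul_sum] at step1
  exact step1.trans (mul_le_mul_of_nonneg_left step2 (by positivity))

end Words

/-- The bound for letters that are themselves words of length `d`, with multiplicative weights,
when at most one of the underlying weights exceeds `q < 1`. -/
theorem sum_array_stabilizer_le {ι : Type*} [Fintype ι] [DecidableEq ι] (n d : ℕ) (v : ι → ℝ)
    (h0 : ∀ i, 0 ≤ v i) (h1 : ∀ i, v i ≤ 1) {q : ℝ} (hq : q < 1)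
    (hv : ∀ i j, q < v i → q < v j → i = j) :
    ∑ a : Fin n → Fin d → ι, (∏ i, ∏ j, v (a i j)) *
      ((Finset.univ.filter fun σ : Equiv.Perm (Fin n) => a ∘ σ = a).card : ℝ)
      ≤ n.factorial * Real.exp ((∑ i, v i) ^ d / (1 - q)) := by
  classical
  set Λ : (Fin d → ι) → ℝ := fun m => ∏ j, v (m j) with hΛ
  have hΛ0 : ∀ m, 0 ≤ Λ m := fun m => Finset.prod_nonneg fun j _ => h0 _
  set B : Finset (Fin d → ι) := Finset.univ.filter fun m => ∃ j, v (m j) ≤ q with hBdef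
  have hBq : ∀ m ∈ B, Λ m ≤ q := by
    intro m hm
    obtain ⟨j, hj⟩ := (Finset.mem_filter.1 hm).2
    rw [hΛ]
    dsimp only
    rw [← Finset.mul_prod_erase _ _ (Finset.mem_univ j)]
    exact (mul_le_of_le_one_right (h0 _)
      (Finset.prod_le_one (fun _ _ => h0 _) fun _ _ => h1 _)).trans hj
  have main := sum_word_stabilizer_le n Λ hΛ0
    (fun m => Finset.prod_le_one (fun _ _ => h0 _) fun _ _ => h1 _) B
    (fun m hm => (hBq m hm).trans_lt hq) (by
      intro m hm m' hm'
      simp only [hBdef, Finset.mem_filter, Finset.mem_univ, true_and, not_exists, not_le] at hm hm'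
      funext j
      exact hv _ _ (hm j) (hm' j))
  refine main.trans (mul_le_mul_of_nonneg_left ?_ (by positivity))
  have hq' : 0 < 1 - q := by linarith
  calc ∏ m ∈ B, (1 - Λ m)⁻¹ ≤ ∏ m ∈ B, Real.exp (Λ m / (1 - q)) := by
        refine Finset.prod_le_prod (fun m hm => ?_) fun m hm => ?_
        · have := hBq m hm
          exact inv_nonneg.2 (by linarith)
        · have hm := hBq m hm
          have hpos : 0 < 1 - Λ m := by linarith
          have e : (1 - Λ m)⁻¹ = Λ m / (1 - Λ m) + 1 := by field_simp; ring
          rw [e]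
          refine (Real.add_one_le_exp _).trans (Real.exp_le_exp.2 ?_)
          exact div_le_div_of_nonneg_left (hΛ0 m) hq' (by linarith)
    _ = Real.exp ((∑ m ∈ B, Λ m) / (1 - q)) := by rw [Finset.sum_div, Real.exp_sum]
    _ ≤ Real.exp ((∑ i, v i) ^ d / (1 - q)) := by
        refine Real.exp_le_exp.2 (div_le_div_of_nonneg_right ?_ hq'.le)
        have e : (∑ i, v i) ^ d = ∑ m, Λ m := by
          have := Finset.prod_univ_sum (fun _ : Fin d => (Finset.univ : Finset ι)) fun _ i => v i
          simpa [hΛ] using this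
        rw [e]
        exact Finset.sum_le_sum_of_subset_of_nonneg (Finset.subset_univ B) fun m _ _ => hΛ0 m

/-! ### Eigenvectors of compact symmetric operators -/

section Eigenvectors

open Module.End

variable {H : Type*} [NormedAddCommGroup H] [InnerProductSpace ℝ H] [CompleteSpace H]

/-- An enumeration of the nonzero eigenvalues with multiplicity is realized by orthonormal
eigenvectors which exhaust all eigenspaces of nonzero eigenvalues. -/
theorem exists_orthonormal_eigenvectors {T : H →L[ℝ] H} (hT : IsCompactOperator T)
    (hT' : T.IsSymmetric) {lam : ℕ → ℝ}
    (hlam : ∀ μ : ℝ, μ ≠ 0 → {i | lam i = μ}.encard =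
      Cardinal.toENat (Module.rank ℝ (eigenspace (T : Module.End ℝ H) μ))) :
    ∃ e : ℕ → H, Orthonormal ℝ (fun i : {i // lam i ≠ 0} => e i) ∧
      (∀ i, lam i = 0 → e i = 0) ∧ (∀ i, T (e i) = lam i • e i) ∧
      ∀ (μ : ℝ) v, μ ≠ 0 → T v = μ • v → (∀ i, lam i ≠ 0 → inner ℝ (e i) v = 0) → v = 0 := by
  have hb : ∀ μ : ℝ, μ ≠ 0 → ∃ b : {i // lam i = μ} → H, Orthonormal ℝ b ∧
      (∀ i, b i ∈ eigenspace (T : Module.End ℝ H) μ) ∧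
      ∀ v, T v = μ • v → (∀ i, inner ℝ (b i) v = 0) → v = 0 := by
    intro μ hμ
    have : FiniteDimensional ℝ (eigenspace (T : Module.End ℝ H) μ) :=
      ContinuousLinearMap.finite_dimensional_eigenspace hT μ hμ
    have h := hlam μ hμ
    rw [← Module.finrank_eq_rank, map_natCast] at h
    have hfin : {i | lam i = μ}.Finite := Set.finite_of_encard_eq_coe h
    have : Finite {i // lam i = μ} := hfin
    have hcard : Nat.card {i // lam i = μ} =
        Module.finrank ℝ (eigenspace (T : Module.End ℝ H) μ) := by
      have h1 : Set.ncard {i | lam i = μ} = _ := congrArg ENat.toNat h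
      rw [ENat.toNat_natCast] at h1
      exact h1
    let B := stdOrthonormalBasis ℝ (eigenspace (T : Module.End ℝ H) μ)
    let φ := Finite.equivFinOfCardEq hcard
    refine ⟨fun i => B (φ i), ?_, fun i => Subtype.prop _, fun v hv horth => ?_⟩
    · have h1 := B.orthonormal.comp φ φ.injective
      rw [orthonormal_iff_ite] at h1 ⊢
      exact h1
    · have hv' : v ∈ eigenspace (T : Module.End ℝ H) μ := mem_eigenspace_iff.2 hv
      have : (⟨v, hv'⟩ : eigenspace (T : Module.End ℝ H) μ) = 0 := by
        rw [← B.sum_repr' ⟨v, hv'⟩]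
        refine Finset.sum_eq_zero fun i _ => ?_
        have h1 : inner ℝ (B i) ⟨v, hv'⟩ = 0 := by
          rw [Submodule.coe_inner]
          simpa using horth (φ.symm i)
        rw [h1, zero_smul]
      exact congrArg Subtype.val this
  choose b hbon hbmem hbexh using hb
  classical
  set e : ℕ → H := fun i => if h : lam i ≠ 0 then b (lam i) h ⟨i, rfl⟩ else 0 with he
  have key : ∀ μ (hμ : μ ≠ 0) i (hi : lam i = μ), e i = b μ hμ ⟨i, hi⟩ := by
    intro μ hμ i hi
    subst hi
    simp [he, hμ]
  have hmem : ∀ i, lam i ≠ 0 → e i ∈ eigenspace (T : Module.End ℝ H) (lam i) := by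
    intro i hi
    rw [key _ hi i rfl]
    exact hbmem _ _ _
  have hTe : ∀ i, T (e i) = lam i • e i := by
    intro i
    by_cases hi : lam i = 0
    · simp [he, hi]
    · exact mem_eigenspace_iff.1 (hmem i hi)
  refine ⟨e, ?_, fun i hi => by simp [he, hi], hTe, ?_⟩
  · rw [orthonormal_iff_ite]
    rintro ⟨i, hi⟩ ⟨j, hj⟩
    by_cases hij : lam i = lam j
    · rw [key _ hj i hij, key _ hj j rfl, orthonormal_iff_ite.1 (hbon _ hj)]
      simp
    · have hne : i ≠ j := fun h => hij (by rw [h])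
      have := hT'.orthogonalFamily_eigenspaces hij ⟨e i, hmem i hi⟩ ⟨e j, hmem j hj⟩
      simpa [hne] using this
  · intro μ v hμ hv horth
    refine hbexh μ hμ v hv fun i => ?_
    rw [← key μ hμ i i.2]
    exact horth i (by rw [i.2]; exact hμ)

end Eigenvectors

/-! ### Integral operators with square-integrable kernels -/

section Kernels

variable {X : Type*} [MeasurableSpace X] {Q : Measure X}

theorem L2_inner_eq_integral {Y : Type*} [MeasurableSpace Y] {μ : Measure Y} (f g : Lp ℝ 2 μ) :
    inner ℝ f g = ∫ y, f y * g y ∂μ := by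
  rw [L2.inner_def]
  refine integral_congr_ae (Eventually.of_forall fun y => ?_)
  simp [mul_comm]

theorem memLp_tensor [SFinite Q] {f g : X → ℝ} (hf : MemLp f 2 Q) (hg : MemLp g 2 Q) :
    MemLp (fun p : X × X => f p.1 * g p.2) 2 (Q.prod Q) := by
  have hm : AEStronglyMeasurable (fun p : X × X => f p.1 * g p.2) (Q.prod Q) :=
    hf.1.comp_fst.mul hg.1.comp_snd
  rw [memLp_two_iff_integrable_sq hm]
  refine (((memLp_two_iff_integrable_sq hf.1).1 hf).mul_prod
    ((memLp_two_iff_integrable_sq hg.1).1 hg)).congr (Eventually.of_forall fun p => ?_)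
  simp only [mul_pow]

theorem ae_prod_of_ae_fst [SFinite Q] {p : X → Prop} (h : ∀ᵐ x ∂Q, p x) :
    ∀ᵐ z ∂(Q.prod Q), p z.1 :=
  Measure.quasiMeasurePreserving_fst.ae h

theorem ae_prod_of_ae_snd [SFinite Q] {p : X → Prop} (h : ∀ᵐ x ∂Q, p x) :
    ∀ᵐ z ∂(Q.prod Q), p z.2 :=
  Measure.quasiMeasurePreserving_snd.ae h

variable [IsProbabilityMeasure Q]

/-- The elementary tensor `g ⊗ h`, that is `(x, y) ↦ g x * h y`, as an element of `L²(Q × Q)`. -/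
noncomputable def tensorFun (g h : Lp ℝ 2 Q) : Lp ℝ 2 (Q.prod Q) :=
  (memLp_tensor (Lp.memLp g) (Lp.memLp h)).toLp _

theorem coeFn_tensorFun (g h : Lp ℝ 2 Q) :
    tensorFun g h =ᵐ[Q.prod Q] fun p => g p.1 * h p.2 :=
  MemLp.coeFn_toLp _

theorem inner_tensorFun_tensorFun (g h g' h' : Lp ℝ 2 Q) :
    inner ℝ (tensorFun g h) (tensorFun g' h') = inner ℝ g g' * inner ℝ h h' := by
  rw [L2_inner_eq_integral, L2_inner_eq_integral, L2_inner_eq_integral, ← integral_prod_mul]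
  refine integral_congr_ae ?_
  filter_upwards [coeFn_tensorFun g h, coeFn_tensorFun g' h'] with p h1 h2
  rw [h1, h2]
  ring

theorem norm_tensorFun (g h : Lp ℝ 2 Q) : ‖tensorFun g h‖ = ‖g‖ * ‖h‖ := by
  have h1 := inner_tensorFun_tensorFun g h g h
  rw [real_inner_self_eq_norm_sq, real_inner_self_eq_norm_sq, real_inner_self_eq_norm_sq,
    ← mul_pow] at h1
  exact (pow_left_inj₀ (norm_nonneg _) (by positivity) two_ne_zero).1 h1

variable (Q) in
/-- The bounded bilinear map `(g, h) ↦ g ⊗ h` from `L²(Q)` to `L²(Q × Q)`. -/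
noncomputable def tensorL2 : Lp ℝ 2 Q →L[ℝ] Lp ℝ 2 Q →L[ℝ] Lp ℝ 2 (Q.prod Q) :=
  LinearMap.mkContinuous₂
    (LinearMap.mk₂ ℝ tensorFun
      (fun g g' h => by
        ext1
        filter_upwards [coeFn_tensorFun (g + g') h, coeFn_tensorFun g h, coeFn_tensorFun g' h,
          Lp.coeFn_add (tensorFun g h) (tensorFun g' h),
          ae_prod_of_ae_fst (Lp.coeFn_add g g')] with p h1 h2 h3 h4 h5
        rw [h1, h4, Pi.add_apply, h2, h3, h5, Pi.add_apply, add_mul])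
      (fun c g h => by
        ext1
        filter_upwards [coeFn_tensorFun (c • g) h, coeFn_tensorFun g h,
          Lp.coeFn_smul c (tensorFun g h),
          ae_prod_of_ae_fst (Lp.coeFn_smul c g)] with p h1 h2 h4 h5
        rw [h1, h4, Pi.smul_apply, h2, h5, Pi.smul_apply, smul_eq_mul, smul_eq_mul, mul_assoc])
      (fun g h h' => by
        ext1
        filter_upwards [coeFn_tensorFun g (h + h'), coeFn_tensorFun g h, coeFn_tensorFun g h',
          Lp.coeFn_add (tensorFun g h) (tensorFun g h'),
          ae_prod_of_ae_snd (Lp.coeFn_add h h')] with p h1 h2 h3 h4 h5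
        rw [h1, h4, Pi.add_apply, h2, h3, h5, Pi.add_apply, mul_add])
      (fun c g h => by
        ext1
        filter_upwards [coeFn_tensorFun g (c • h), coeFn_tensorFun g h,
          Lp.coeFn_smul c (tensorFun g h),
          ae_prod_of_ae_snd (Lp.coeFn_smul c h)] with p h1 h2 h4 h5
        rw [h1, h4, Pi.smul_apply, h2, h5, Pi.smul_apply, smul_eq_mul, smul_eq_mul,
          mul_left_comm])) 1
    (fun g h => by rw [LinearMap.mk₂_apply, norm_tensorFun, one_mul])

@[simp] theorem tensorL2_apply (g h : Lp ℝ 2 Q) : tensorL2 Q g h = tensorFun g h := rfl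

/-- Indicators of rectangles are elementary tensors, so these span a dense subspace. -/
theorem eq_zero_of_inner_tensorFun_eq_zero (k : Lp ℝ 2 (Q.prod Q))
    (hk : ∀ g h, inner ℝ k (tensorFun g h) = 0) : k = 0 := by
  have hint : Integrable k (Q.prod Q) := (Lp.memLp k).integrable (by norm_num)
  have hrect : ∀ A B : Set X, MeasurableSet A → MeasurableSet B →
      ∫ p in A ×ˢ B, k p ∂(Q.prod Q) = 0 := by
    intro A B hA hB
    have h := hk (indicatorConstLp 2 hA (measure_ne_top Q A) 1)
      (indicatorConstLp 2 hB (measure_ne_top Q B) 1)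
    rw [L2_inner_eq_integral] at h
    rw [← h, ← integral_indicator (hA.prod hB)]
    refine integral_congr_ae ?_
    filter_upwards [coeFn_tensorFun (indicatorConstLp 2 hA (measure_ne_top Q A) (1 : ℝ))
      (indicatorConstLp 2 hB (measure_ne_top Q B) (1 : ℝ)),
      ae_prod_of_ae_fst (indicatorConstLp_coeFn (p := 2) (hs := hA) (hμs := measure_ne_top Q A)
        (c := (1 : ℝ))),
      ae_prod_of_ae_snd (indicatorConstLp_coeFn (p := 2) (hs := hB) (hμs := measure_ne_top Q B)
        (c := (1 : ℝ)))] with p h1 h2 h3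
    rw [h1, h2, h3]
    by_cases hpA : p.1 ∈ A <;> by_cases hpB : p.2 ∈ B <;>
      simp [Set.indicator, hpA, hpB]
  have hall : ∀ s, MeasurableSet s → ∫ p in s, k p ∂(Q.prod Q) = 0 := by
    have huniv : ∫ p, k p ∂(Q.prod Q) = 0 := by
      have := hrect Set.univ Set.univ .univ .univ
      rwa [Set.univ_prod_univ, setIntegral_univ] at this
    refine MeasurableSpace.induction_on_inter generateFrom_prod.symm isPiSystem_prod
      (by simp) ?_ ?_ ?_
    · rintro _ ⟨A, hA, B, hB, rfl⟩
      exact hrect A B hA hB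
    · intro t ht h
      have := integral_add_compl ht hint
      rw [h, huniv, zero_add] at this
      exact this
    · intro f hd hf h
      rw [integral_iUnion hf hd hint.integrableOn]
      simp [h]
  rw [Lp.eq_zero_iff_ae_eq_zero]
  exact Lp.ae_eq_zero_of_forall_setIntegral_eq_zero k (by norm_num) (by norm_num)
    (fun s _ _ => hint.integrableOn) fun s hs _ => hall s hs

/-- The operator on `L²(Q)` with kernel `k ∈ L²(Q × Q)`, defined by
`⟪kernelOp k h, g⟫ = ⟪k, g ⊗ h⟫`. -/
noncomputable def kernelOp : Lp ℝ 2 (Q.prod Q) →L[ℝ] Lp ℝ 2 Q →L[ℝ] Lp ℝ 2 Q :=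
  LinearMap.mkContinuous₂
    (LinearMap.mk₂ ℝ (fun k h => ContinuousLinearMap.adjoint ((tensorL2 Q).flip h) k)
      (fun k k' h => by rw [map_add])
      (fun c k h => by rw [map_smul])
      (fun k h h' => by rw [map_add, map_add, _root_.add_apply])
      (fun c k h => by
        refine ext_inner_right ℝ fun v => ?_
        rw [ContinuousLinearMap.adjoint_inner_left, inner_smul_left,
          ContinuousLinearMap.adjoint_inner_left, map_smul, _root_.smul_apply,
          inner_smul_right]
        simp)) 1
    (fun k h => by
      rw [LinearMap.mk₂_apply, one_mul, mul_comm]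
      refine (ContinuousLinearMap.le_opNorm _ _).trans
        (mul_le_mul_of_nonneg_right ?_ (norm_nonneg _))
      rw [LinearIsometryEquiv.norm_map]
      refine ContinuousLinearMap.opNorm_le_bound _ (norm_nonneg _) fun g => ?_
      rw [ContinuousLinearMap.flip_apply, tensorL2_apply, norm_tensorFun, mul_comm])

theorem inner_kernelOp (k : Lp ℝ 2 (Q.prod Q)) (h g : Lp ℝ 2 Q) :
    inner ℝ (kernelOp k h) g = inner ℝ k (tensorFun g h) := by
  show inner ℝ (ContinuousLinearMap.adjoint ((tensorL2 Q).flip h) k) g = _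
  rw [ContinuousLinearMap.adjoint_inner_left]
  rfl

theorem kernelOp_eq_zero_iff {k : Lp ℝ 2 (Q.prod Q)} : kernelOp k = 0 ↔ k = 0 := by
  refine ⟨fun h => eq_zero_of_inner_tensorFun_eq_zero k fun g f => ?_, fun h => by simp [h]⟩
  rw [← inner_kernelOp, h]
  simp

theorem kernelOp_tensorFun (a b h : Lp ℝ 2 Q) :
    kernelOp (tensorFun a b) h = inner ℝ b h • a := by
  refine ext_inner_right ℝ fun v => ?_
  rw [inner_kernelOp, inner_tensorFun_tensorFun, inner_smul_left, mul_comm]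
  simp

/-- Hilbert–Schmidt operators are compact: the kernels of compact operators form a closed subspace
containing all elementary tensors, whose operators have rank one. -/
theorem isCompactOperator_kernelOp (k : Lp ℝ 2 (Q.prod Q)) : IsCompactOperator (kernelOp k) := by
  let V : Submodule ℝ (Lp ℝ 2 (Q.prod Q)) :=
    { carrier := {k | IsCompactOperator (kernelOp k)}
      zero_mem' := by
        show IsCompactOperator (kernelOp (0 : Lp ℝ 2 (Q.prod Q)))
        rw [map_zero]
        exact isCompactOperator_zero
      add_mem' := fun {a b} ha hb => by
        show IsCompactOperator (kernelOp (a + b))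
        rw [map_add]
        exact IsCompactOperator.add ha hb
      smul_mem' := fun c a ha => by
        show IsCompactOperator (kernelOp (c • a))
        rw [map_smul]
        exact IsCompactOperator.smul ha c }
  have hV : IsClosed (V : Set (Lp ℝ 2 (Q.prod Q))) :=
    (isClosed_setOfPred_isCompactOperator (σ₁₂ := RingHom.id ℝ) (M₁ := Lp ℝ 2 Q)
      (M₂ := Lp ℝ 2 Q)).preimage (kernelOp (Q := Q)).continuous
  have htens : ∀ a b, tensorFun a b ∈ V := by
    intro a b
    show IsCompactOperator (kernelOp (tensorFun a b))
    have e : (kernelOp (tensorFun a b) : Lp ℝ 2 Q → Lp ℝ 2 Q) =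
        (ContinuousLinearMap.toSpanSingleton ℝ a) ∘ (innerSL ℝ b) := by
      funext h
      simp [kernelOp_tensorFun]
    rw [e]
    exact (isCompactOperator_of_locallyCompactSpace_dom (innerSL ℝ b)).clm_comp _
  have : CompleteSpace V := hV.completeSpace_coe
  have htop : V = ⊤ := by
    rw [← Submodule.orthogonal_eq_bot_iff, Submodule.eq_bot_iff]
    intro r hr
    refine eq_zero_of_inner_tensorFun_eq_zero r fun g h => ?_
    rw [real_inner_comm]
    exact hr _ (htens g h)
  have : k ∈ V := htop ▸ Submodule.mem_top
  exact this

theorem isSymmetric_kernelOp {k : Lp ℝ 2 (Q.prod Q)}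
    (hk : ∀ᵐ p ∂(Q.prod Q), k p.swap = k p) : (kernelOp k).IsSymmetric := by
  intro g h
  show inner ℝ (kernelOp k g) h = inner ℝ g (kernelOp k h)
  rw [real_inner_comm (kernelOp k h) g, inner_kernelOp, inner_kernelOp,
    L2_inner_eq_integral, L2_inner_eq_integral,
    ← (Measure.measurePreserving_swap (μ := Q) (ν := Q)).integral_comp
      (MeasurableEquiv.prodComm (α := X) (β := X)).measurableEmbedding]
  refine integral_congr_ae ?_
  filter_upwards [hk, coeFn_tensorFun g h,
    (Measure.measurePreserving_swap (μ := Q) (ν := Q)).quasiMeasurePreserving.ae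
      (coeFn_tensorFun h g)] with p h1 h2 h3
  rw [h1, h2, h3, Prod.fst_swap, Prod.snd_swap, mul_comm (g p.1)]

/-- The expansion of a symmetric square-integrable kernel in eigenfunctions: `∑ λᵢ eᵢ ⊗ eᵢ`
converges to the kernel in `L²(Q × Q)`. The difference is the kernel of a compact symmetric
operator without nonzero eigenvalues, hence zero. -/
theorem exists_kernel_eigenexpansion {k : Lp ℝ 2 (Q.prod Q)}
    (hk : ∀ᵐ p ∂(Q.prod Q), k p.swap = k p) {lam : ℕ → ℝ}
    (hlam : ∀ μ : ℝ, μ ≠ 0 → {i | lam i = μ}.encard =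
      Cardinal.toENat (Module.rank ℝ (Module.End.eigenspace (kernelOp k).toLinearMap μ))) :
    ∃ e : ℕ → Lp ℝ 2 Q, Orthonormal ℝ (fun i : {i // lam i ≠ 0} => e i) ∧
      (∀ i, lam i = 0 → e i = 0) ∧
      (∀ i, kernelOp k (e i) = lam i • e i) ∧ Summable (fun i => lam i ^ 2) ∧
      HasSum (fun i => lam i • tensorFun (e i) (e i)) k := by
  obtain ⟨e, hon, he0, heig, hexh⟩ := exists_orthonormal_eigenvectors
    (isCompactOperator_kernelOp k) (isSymmetric_kernelOp hk) hlam
  have hon' : Orthonormal ℝ (fun i : {i // lam i ≠ 0} => tensorFun (e i) (e i)) := by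
    rw [orthonormal_iff_ite] at hon ⊢
    intro i j
    rw [inner_tensorFun_tensorFun, hon i j]
    split_ifs <;> simp
  have hinner : ∀ i : {i // lam i ≠ 0}, inner ℝ (tensorFun (e i) (e i)) k = lam i := by
    intro i
    have h1 := orthonormal_iff_ite.1 hon i i
    rw [if_pos rfl] at h1
    rw [real_inner_comm, ← inner_kernelOp, heig, inner_smul_left, h1]
    simp
  have hsq : Summable (fun i : {i // lam i ≠ 0} => lam i ^ 2) := by
    refine (hon'.inner_products_summable k).congr fun i => ?_
    rw [hinner, Real.norm_eq_abs, sq_abs]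
  have hsq' : Summable (fun i => lam i ^ 2) := by
    have := (summable_subtype_iff_indicator (f := fun i => lam i ^ 2) (s := {i | lam i ≠ 0})).1 hsq
    refine this.congr fun i => ?_
    by_cases hi : lam i = 0 <;> simp [Set.indicator, hi]
  have hsum : Summable (fun i : {i // lam i ≠ 0} => lam i • tensorFun (e i) (e i)) := by
    have := (hon'.orthogonalFamily.summable_iff_norm_sq_summable
      (fun i : {i // lam i ≠ 0} => lam i)).2 (by simpa using hsq)
    simpa using this
  have hsum' : Summable (fun i => lam i • tensorFun (e i) (e i)) := by
    have := (summable_subtype_iff_indicator (f := fun i => lam i • tensorFun (e i) (e i))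
      (s := {i | lam i ≠ 0})).1 hsum
    refine this.congr fun i => ?_
    by_cases hi : lam i = 0 <;> simp [Set.indicator, hi]
  refine ⟨e, hon, he0, heig, hsq', ?_⟩
  obtain ⟨K, hK⟩ := hsum'
  suffices h : k - K = 0 by rwa [sub_eq_zero.1 h]
  have hKop : ∀ v, HasSum (fun i => (lam i * inner ℝ (e i) v) • e i) (kernelOp K v) := by
    intro v
    have := (hK.mapL (kernelOp (Q := Q))).mapL (ContinuousLinearMap.apply ℝ (Lp ℝ 2 Q) v)
    simp only [map_smul, ContinuousLinearMap.apply_apply,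
      kernelOp_tensorFun, smul_smul] at this
    exact this
  have hsymmK : (kernelOp (k - K)).IsSymmetric := by
    have hK' : (kernelOp K).IsSymmetric := by
      intro v w
      show inner ℝ (kernelOp K v) w = inner ℝ v (kernelOp K w)
      have h1 := (hKop v).mapL (innerSL ℝ w)
      have h2 := (hKop w).mapL (innerSL ℝ v)
      simp only [innerSL_apply_apply, inner_smul_right] at h1 h2
      rw [real_inner_comm]
      refine h1.unique (h2.congr_fun fun i => ?_)
      rw [real_inner_comm (e i) w, real_inner_comm (e i) v]
      ring
    have := (isSymmetric_kernelOp hk).sub hK'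
    rwa [map_sub]
  have hRe : ∀ i, kernelOp (k - K) (e i) = 0 := by
    intro i
    rw [map_sub, _root_.sub_apply, heig, sub_eq_zero]
    refine HasSum.unique ?_ (hKop (e i))
    have h1 : ∀ j, j ≠ i → (lam j * inner ℝ (e j) (e i)) • e j = 0 := by
      intro j hj
      by_cases hj0 : lam j = 0
      · simp [hj0]
      by_cases hi0 : lam i = 0
      · simp [he0 i hi0]
      have := orthonormal_iff_ite.1 hon ⟨j, hj0⟩ ⟨i, hi0⟩
      rw [if_neg (by simpa using hj)] at this
      simp [this]
    have h2 := hasSum_single i h1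
    have h3 : (lam i * inner ℝ (e i) (e i)) • e i = lam i • e i := by
      by_cases hi0 : lam i = 0
      · simp [hi0]
      have := orthonormal_iff_ite.1 hon ⟨i, hi0⟩ ⟨i, hi0⟩
      rw [if_pos rfl] at this
      rw [this, mul_one]
    rwa [h3] at h2
  rw [← kernelOp_eq_zero_iff]
  refine (ContinuousLinearMap.eq_zero_of_forall_hasEigenvalue_eq_zero
    (isCompactOperator_kernelOp _) hsymmK).1 fun μ hμ => ?_
  by_contra hμ0
  obtain ⟨v, hv, hv0⟩ := hμ.exists_hasEigenvector
  have hv : kernelOp (k - K) v = μ • v := Module.End.mem_eigenspace_iff.1 hv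
  have horth : ∀ i, inner ℝ (e i) v = 0 := by
    intro i
    have h1 : inner ℝ (kernelOp (k - K) (e i)) v = inner ℝ (e i) (kernelOp (k - K) v) :=
      hsymmK (e i) v
    rw [hRe, hv, inner_zero_left, inner_smul_right] at h1
    exact (mul_eq_zero.1 h1.symm).resolve_left hμ0
  have hKv : kernelOp K v = 0 := by
    refine HasSum.unique (hKop v) ?_
    simp [horth, hasSum_zero]
  rw [map_sub, _root_.sub_apply, hKv, sub_zero] at hv
  exact hv0 (hexh μ v hμ0 hv fun i _ => horth i)

end Kernels

/-! ### Eigenfunction expansion of the likelihood -/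

namespace DatabasePair

variable {𝒳 : Type*} [MeasurableSpace 𝒳] (D : DatabasePair 𝒳)

attribute [instance] isProbabilityMeasure_Q

instance isProbabilityMeasure_P : IsProbabilityMeasure D.P := by
  have h : IsProbabilityMeasure (D.P.map Prod.fst) := by rw [D.fst_eq]; infer_instance
  exact (Measure.isProbabilityMeasure_map_iff measurable_fst.aemeasurable).1 h

theorem memLp_likelihood :
    MemLp (fun p : 𝒳 × 𝒳 => D.likelihood p.1 p.2) 2 (D.Q.prod D.Q) := by
  refine ⟨(Measure.measurable_rnDeriv _ _).ennreal_toReal.aestronglyMeasurable, ?_⟩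
  rw [eLpNorm_lt_top_iff_lintegral_rpow_enorm_lt_top (by norm_num) (by norm_num)]
  refine lt_of_le_of_lt (lintegral_mono fun p => ?_) D.square_integrable
  have h : ‖D.likelihood p.1 p.2‖ₑ ≤ D.P.rnDeriv (D.Q.prod D.Q) p := by
    rw [likelihood, Real.enorm_eq_ofReal ENNReal.toReal_nonneg]
    exact ENNReal.ofReal_toReal_le
  calc ‖D.likelihood p.1 p.2‖ₑ ^ (2 : ℝ≥0∞).toReal = ‖D.likelihood p.1 p.2‖ₑ ^ 2 := by
        rw [← ENNReal.rpow_natCast]; norm_num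
    _ ≤ _ := pow_le_pow_left' h 2

/-- The likelihood as an element of `L²(Q × Q)`. -/
noncomputable def likelihoodLp : Lp ℝ 2 (D.Q.prod D.Q) := D.memLp_likelihood.toLp _

theorem coeFn_likelihoodLp :
    D.likelihoodLp =ᵐ[D.Q.prod D.Q] fun p => D.likelihood p.1 p.2 :=
  MemLp.coeFn_toLp _

theorem likelihoodLp_symm : ∀ᵐ p ∂(D.Q.prod D.Q), D.likelihoodLp p.swap = D.likelihoodLp p := by
  filter_upwards [D.coeFn_likelihoodLp,
    (Measure.measurePreserving_swap (μ := D.Q) (ν := D.Q)).quasiMeasurePreserving.ae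
      D.coeFn_likelihoodLp, D.symmetric] with p h1 h2 h3
  rw [h1, h2]
  simp only [likelihood]
  exact congrArg ENNReal.toReal h3

theorem integrable_likelihood_mul (f : Lp ℝ 2 D.Q) :
    Integrable (fun p : 𝒳 × 𝒳 => D.likelihood p.1 p.2 * f p.2) (D.Q.prod D.Q) :=
  D.memLp_likelihood.integrable_mul ((Lp.memLp f).comp_snd D.Q)

theorem kernelOp_likelihoodLp_ae_eq (f : Lp ℝ 2 D.Q) :
    kernelOp D.likelihoodLp f =ᵐ[D.Q] fun x => ∫ y, D.likelihood x y * f y ∂D.Q := by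
  refine Integrable.ae_eq_of_forall_setIntegral_eq _ _ ((Lp.memLp _).integrable (by norm_num))
    (D.integrable_likelihood_mul f).integral_prod_left fun A hA _ => ?_
  have h1 := L2.inner_indicatorConstLp_one (𝕜 := ℝ) hA (measure_ne_top D.Q A)
    (kernelOp D.likelihoodLp f)
  rw [← h1, real_inner_comm, inner_kernelOp, L2_inner_eq_integral]
  have h2 : ∫ p in A ×ˢ Set.univ, D.likelihood p.1 p.2 * f p.2 ∂(D.Q.prod D.Q) =
      ∫ x in A, ∫ y in Set.univ, D.likelihood x y * f y ∂D.Q ∂D.Q :=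
    setIntegral_prod _ (D.integrable_likelihood_mul f).integrableOn
  rw [Measure.restrict_univ] at h2
  rw [← h2, ← integral_indicator (hA.prod .univ)]
  refine integral_congr_ae ?_
  filter_upwards [coeFn_tensorFun (indicatorConstLp 2 hA (measure_ne_top D.Q A) (1 : ℝ)) f,
    ae_prod_of_ae_fst (indicatorConstLp_coeFn (p := 2) (hs := hA) (hμs := measure_ne_top D.Q A)
      (c := (1 : ℝ))), D.coeFn_likelihoodLp] with p h3 h4 h5
  rw [h3, h4, h5]
  by_cases hp : p.1 ∈ A <;> simp [Set.indicator, hp]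

theorem eigenspace_eq (μ : ℝ) :
    D.eigenspace μ = Module.End.eigenspace (kernelOp D.likelihoodLp).toLinearMap μ := by
  ext f
  rw [Module.End.mem_eigenspace_iff]
  have hsmul := Lp.coeFn_smul μ f
  have hker := D.kernelOp_likelihoodLp_ae_eq f
  constructor
  · rintro ⟨-, hf⟩
    show kernelOp D.likelihoodLp f = μ • f
    ext1
    filter_upwards [hsmul, hker, hf] with x h1 h2 h3
    rw [h1, h2, h3, Pi.smul_apply, smul_eq_mul]
  · intro hf
    have hf : kernelOp D.likelihoodLp f = μ • f := hf
    refine ⟨(D.integrable_likelihood_mul f).prod_right_ae, ?_⟩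
    rw [hf] at hker
    filter_upwards [hsmul, hker] with x h1 h2
    rw [← h2, h1, Pi.smul_apply, smul_eq_mul]

/-- The operator with kernel the likelihood is a contraction in the sense of quadratic forms,
since both marginals of `P` are `Q`. -/
theorem abs_inner_kernelOp_likelihoodLp_le (f : Lp ℝ 2 D.Q) :
    |inner ℝ (kernelOp D.likelihoodLp f) f| ≤ ‖f‖ ^ 2 := by
  have hsq : Integrable (fun x => f x ^ 2) D.Q := (Lp.memLp f).integrable_sq
  have hI : ∫ x, f x ^ 2 ∂D.Q = ‖f‖ ^ 2 := by
    rw [← real_inner_self_eq_norm_sq, L2_inner_eq_integral]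
    simp only [sq]
  have hmf : AEStronglyMeasurable (fun x => f x ^ 2) D.Q := hsq.1
  have h1 : Integrable (fun p : 𝒳 × 𝒳 => f p.1 ^ 2) D.P := by
    have : Integrable (fun x => f x ^ 2) (D.P.map Prod.fst) := by rwa [D.fst_eq]
    exact this.comp_measurable measurable_fst
  have h2 : Integrable (fun p : 𝒳 × 𝒳 => f p.2 ^ 2) D.P := by
    have : Integrable (fun x => f x ^ 2) (D.P.map Prod.snd) := by rwa [D.snd_eq]
    exact this.comp_measurable measurable_snd
  have e1 : ∫ p, f p.1 ^ 2 ∂D.P = ‖f‖ ^ 2 := by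
    have h := integral_map (μ := D.P) (f := fun x => f x ^ 2) measurable_fst.aemeasurable
      (by rwa [D.fst_eq])
    rw [D.fst_eq, hI] at h
    exact h.symm
  have e2 : ∫ p, f p.2 ^ 2 ∂D.P = ‖f‖ ^ 2 := by
    have h := integral_map (μ := D.P) (f := fun x => f x ^ 2) measurable_snd.aemeasurable
      (by rwa [D.snd_eq])
    rw [D.snd_eq, hI] at h
    exact h.symm
  have e3 : inner ℝ (kernelOp D.likelihoodLp f) f = ∫ p, f p.1 * f p.2 ∂D.P := by
    rw [inner_kernelOp, L2_inner_eq_integral,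
      ← integral_rnDeriv_smul D.absolutelyContinuous]
    refine integral_congr_ae ?_
    filter_upwards [D.coeFn_likelihoodLp, coeFn_tensorFun f f] with p h3 h4
    rw [h3, h4, smul_eq_mul]
    rfl
  rw [e3, ← Real.norm_eq_abs]
  calc ‖∫ p, f p.1 * f p.2 ∂D.P‖ ≤ ∫ p, (f p.1 ^ 2 + f p.2 ^ 2) / 2 ∂D.P := by
        refine norm_integral_le_of_norm_le ((h1.add h2).div_const 2)
          (Eventually.of_forall fun p => ?_)
        rw [Real.norm_eq_abs, abs_le]
        constructor <;> nlinarith [sq_nonneg (f p.1 + f p.2), sq_nonneg (f p.1 - f p.2)]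
    _ = ‖f‖ ^ 2 := by
        rw [integral_div, integral_add h1 h2, e1, e2]
        ring

/-- The eigenfunction expansion of the likelihood with measurable representatives, converging almost
everywhere along a subsequence of partial sums. Orthonormality is asserted only for indices with
nonzero `lam i`, since the padding zeros of the sequence need not come from eigenvectors. -/
theorem exists_likelihood_eigenexpansion {lam : ℕ → ℝ} (hlam : D.IsEigenvalueSeq lam) :
    Summable (fun i => lam i ^ 2) ∧ (∀ i, |lam i| ≤ 1) ∧
    ∃ f : ℕ → 𝒳 → ℝ, (∀ i, Measurable (f i)) ∧ (∀ i, MemLp (f i) 2 D.Q) ∧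
      (∀ i j, lam i ≠ 0 → lam j ≠ 0 → ∫ x, f i x * f j x ∂D.Q = if i = j then 1 else 0) ∧
      ∃ N : ℕ → ℕ, ∀ᵐ p ∂(D.Q.prod D.Q),
        Tendsto (fun m => ∑ i ∈ Finset.range (N m), lam i * (f i p.1 * f i p.2)) atTop
          (𝓝 (D.likelihood p.1 p.2)) := by
  obtain ⟨e, hon, he0, heig, hsq, hsum⟩ := exists_kernel_eigenexpansion D.likelihoodLp_symm
    (lam := lam) fun μ hμ => by rw [hlam.2 μ hμ, D.eigenspace_eq]
  refine ⟨hsq, fun i => ?_, fun i => e i, fun i => (Lp.stronglyMeasurable _).measurable,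
    fun i => Lp.memLp _, fun i j hi hj => ?_, ?_⟩
  · by_cases hi : lam i = 0
    · simp [hi]
    have h1 := D.abs_inner_kernelOp_likelihoodLp_le (e i)
    have h2 : ‖e i‖ = 1 := hon.1 ⟨i, hi⟩
    rw [heig, inner_smul_left, real_inner_self_eq_norm_sq, h2] at h1
    simpa using h1
  · rw [← L2_inner_eq_integral]
    have := orthonormal_iff_ite.1 hon ⟨i, hi⟩ ⟨j, hj⟩
    simpa using this
  · obtain ⟨N, -, hN⟩ := (tendstoInMeasure_of_tendsto_Lp hsum.tendsto_sum_nat).exists_seq_tendsto_ae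
    refine ⟨N, ?_⟩
    have hpart : ∀ m : ℕ, ∀ᵐ p ∂(D.Q.prod D.Q),
        (∑ i ∈ Finset.range m, lam i • tensorFun (e i) (e i) : Lp ℝ 2 (D.Q.prod D.Q)) p =
        ∑ i ∈ Finset.range m, lam i * (e i p.1 * e i p.2) := by
      intro m
      induction m with
      | zero =>
        simp only [Finset.range_zero, Finset.sum_empty]
        exact Lp.coeFn_zero _ _ _
      | succ m ih =>
        rw [Finset.sum_range_succ]
        filter_upwards [ih, Lp.coeFn_add
          (∑ i ∈ Finset.range m, lam i • tensorFun (e i) (e i)) (lam m • tensorFun (e m) (e m)),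
          Lp.coeFn_smul (lam m) (tensorFun (e m) (e m)), coeFn_tensorFun (e m) (e m)]
          with p h1 h2 h3 h4
        rw [h2, Pi.add_apply, h1, h3, Pi.smul_apply, h4, smul_eq_mul, Finset.sum_range_succ]
    filter_upwards [hN, ae_all_iff.2 hpart, D.coeFn_likelihoodLp] with p h1 h2 h3
    rw [← h3]
    exact h1.congr fun m => h2 _

end DatabasePair

/-! ### Densities of the alternatives -/

theorem lintegral_pi_prod {ι : Type*} [Fintype ι] {α : Type*} [MeasurableSpace α]
    {μ : Measure α} [IsProbabilityMeasure μ] {f : ι → α → ℝ≥0∞} (hf : ∀ i, Measurable (f i)) :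
    ∫⁻ x, ∏ i, f i (x i) ∂(Measure.pi fun _ : ι => μ) = ∏ i, ∫⁻ x, f i x ∂μ := by
  have hind := ProbabilityTheory.iIndepFun_pi (μ := fun _ : ι => μ) (X := f)
    fun i => (hf i).aemeasurable
  rw [ProbabilityTheory.lintegral_prod_eq_prod_lintegral_of_indepFun Finset.univ _ hind
    fun i => (hf i).comp (measurable_pi_apply i)]
  refine Finset.prod_congr rfl fun i _ => ?_
  exact (measurePreserving_eval (fun _ : ι => μ) i).lintegral_comp (hf i)

theorem pi_eq_withDensity {ι : Type*} [Fintype ι] {α : Type*} [MeasurableSpace α]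
    {μ ν : Measure α} [IsProbabilityMeasure μ] [IsProbabilityMeasure ν] {f : α → ℝ≥0∞}
    (hf : Measurable f) (h : ν = μ.withDensity f) :
    (Measure.pi fun _ : ι => ν) =
      (Measure.pi fun _ : ι => μ).withDensity fun x => ∏ i, f (x i) := by
  refine Measure.pi_eq fun s hs => ?_
  have hbox : MeasurableSet (Set.univ.pi s) := MeasurableSet.univ_pi hs
  rw [withDensity_apply _ hbox, ← lintegral_indicator hbox]
  have e : ∀ x : ι → α, (Set.univ.pi s).indicator (fun x => ∏ i, f (x i)) x =
      ∏ i, (s i).indicator f (x i) := by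
    intro x
    by_cases hx : x ∈ Set.univ.pi s
    · rw [Set.indicator_of_mem hx]
      exact Finset.prod_congr rfl fun i _ =>
        (Set.indicator_of_mem (hx i (Set.mem_univ i)) _).symm
    · rw [Set.indicator_of_notMem hx]
      simp only [Set.mem_univ_pi, not_forall] at hx
      obtain ⟨i, hi⟩ := hx
      exact (Finset.prod_eq_zero (Finset.mem_univ i) (Set.indicator_of_notMem hi _)).symm
  simp_rw [e]
  rw [lintegral_pi_prod fun i => hf.indicator (hs i)]
  refine Finset.prod_congr rfl fun i _ => ?_
  rw [lintegral_indicator (hs i), h, withDensity_apply _ (hs i)]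

theorem map_withDensity_comp {α β : Type*} [MeasurableSpace α] [MeasurableSpace β]
    {μ : Measure α} {ν : Measure β} {g : α → β} (hg : MeasurePreserving g μ ν)
    {f : β → ℝ≥0∞} (hf : Measurable f) :
    (μ.withDensity fun x => f (g x)).map g = ν.withDensity f := by
  ext s hs
  rw [Measure.map_apply hg.measurable hs, withDensity_apply _ (hg.measurable hs),
    withDensity_apply _ hs, ← hg.map_eq, setLIntegral_map hs hf hg.measurable]

theorem withDensity_finsetSum {α ι : Type*} [MeasurableSpace α] (μ : Measure α) (s : Finset ι)
    {f : ι → α → ℝ≥0∞} (hf : ∀ i, Measurable (f i)) :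
    μ.withDensity (fun x => ∑ i ∈ s, f i x) = ∑ i ∈ s, μ.withDensity (f i) := by
  classical
  induction s using Finset.induction_on with
  | empty => simp only [Finset.sum_empty]; exact withDensity_zero
  | insert a s ha ih =>
    simp only [Finset.sum_insert ha]
    rw [← ih]
    exact withDensity_add_left (hf a) _

namespace DatabasePair

variable {𝒳 : Type*} [MeasurableSpace 𝒳] (D : DatabasePair 𝒳) (n d : ℕ)

instance isProbabilityMeasure_null : IsProbabilityMeasure (D.null n d) := by
  unfold null; infer_instance

/-- The density of the alternative given `σ` with respect to the null distribution. -/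
noncomputable def altDensity (σ : Equiv.Perm (Fin n)) (z : Data 𝒳 n d) : ℝ≥0∞ :=
  ∏ i, ∏ j, D.P.rnDeriv (D.Q.prod D.Q) (z.1 i j, z.2 (σ i) j)

theorem measurable_altDensity (σ : Equiv.Perm (Fin n)) : Measurable (D.altDensity n d σ) := by
  refine Finset.measurable_fun_prod _ fun i _ => Finset.measurable_fun_prod _ fun j _ => ?_
  exact (Measure.measurable_rnDeriv _ _).comp (by fun_prop)

/-- Reading off two databases, matched by `σ`, from independent pairs of entries with law `Q × Q`
gives the null distribution. -/
theorem measurePreserving_unzip (σ : Equiv.Perm (Fin n)) :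
    MeasurePreserving
      (fun w : Fin n → Fin d → 𝒳 × 𝒳 =>
        ((fun i j => (w i j).1, fun l j => (w (σ.symm l) j).2) : Data 𝒳 n d))
      (Measure.pi fun _ : Fin n => Measure.pi fun _ : Fin d => D.Q.prod D.Q) (D.null n d) := by
  have h1 := measurePreserving_pi (fun _ : Fin n => Measure.pi fun _ : Fin d => D.Q.prod D.Q) _
    fun _ => measurePreserving_arrowProdEquivProdArrow 𝒳 𝒳 (Fin d) (fun _ => D.Q) fun _ => D.Q
  have h2 := measurePreserving_arrowProdEquivProdArrow (Fin d → 𝒳) (Fin d → 𝒳) (Fin n)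
    (fun _ => Measure.pi fun _ => D.Q) fun _ => Measure.pi fun _ => D.Q
  have h3 := measurePreserving_arrowCongr' (fun _ : Fin n => Measure.pi fun _ : Fin d => D.Q)
    (fun _ : Fin n => Measure.pi fun _ : Fin d => D.Q) σ (MeasurableEquiv.refl _)
    fun _ => MeasurePreserving.id _
  exact ((MeasurePreserving.id _).prod h3).comp (h2.comp h1)

theorem alt_eq_withDensity (σ : Equiv.Perm (Fin n)) :
    D.alt n d σ = (D.null n d).withDensity (D.altDensity n d σ) := by
  have hR := Measure.measurable_rnDeriv D.P (D.Q.prod D.Q)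
  have h1 : (Measure.pi fun _ : Fin d => D.P) = _ := pi_eq_withDensity hR
    (Measure.withDensity_rnDeriv_eq _ _ D.absolutelyContinuous).symm
  have h2 : (Measure.pi fun _ : Fin n => Measure.pi fun _ : Fin d => D.P) = _ :=
    pi_eq_withDensity (Finset.measurable_fun_prod _ fun j _ =>
      hR.comp (measurable_pi_apply j)) h1
  rw [alt, h2, ← map_withDensity_comp (D.measurePreserving_unzip n d σ)
    (D.measurable_altDensity n d σ)]
  simp only [altDensity, Equiv.symm_apply_apply]
  rfl

/-- The likelihood ratio of the mixture. -/
noncomputable def mixtureDensity (z : Data 𝒳 n d) : ℝ≥0∞ :=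
  (Fintype.card (Equiv.Perm (Fin n)) : ℝ≥0∞)⁻¹ * ∑ σ, D.altDensity n d σ z

theorem measurable_mixtureDensity : Measurable (D.mixtureDensity n d) :=
  (Finset.measurable_fun_sum _ fun σ _ => D.measurable_altDensity n d σ).const_mul _

theorem mixture_eq_withDensity :
    D.mixture n d = (D.null n d).withDensity (D.mixtureDensity n d) := by
  have h : D.mixtureDensity n d =
      (Fintype.card (Equiv.Perm (Fin n)) : ℝ≥0∞)⁻¹ • fun z => ∑ σ, D.altDensity n d σ z := rfl
  rw [h, withDensity_smul _ (Finset.measurable_fun_sum _ fun σ _ => D.measurable_altDensity n d σ),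
    withDensity_finsetSum _ _ fun σ => D.measurable_altDensity n d σ, mixture]
  simp only [alt_eq_withDensity]

theorem secondMoment_eq :
    D.secondMoment n d = ∫⁻ z, D.mixtureDensity n d z ^ 2 ∂(D.null n d) := by
  refine lintegral_congr_ae ?_
  rw [mixture_eq_withDensity]
  filter_upwards [Measure.rnDeriv_withDensity (D.null n d) (D.measurable_mixtureDensity n d)]
    with z hz
  rw [hz]

end DatabasePair

/-! ### Second moment for kernels of finite rank -/

section FiniteRank

variable {𝒳 : Type*} [MeasurableSpace 𝒳] {Q : Measure 𝒳} [IsProbabilityMeasure Q]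
  {ι : Type*} [Fintype ι] [DecidableEq ι]

/-- The product of the functions `f (a i j)` of the entries of an array. -/
def arrayFun (f : ι → 𝒳 → ℝ) {n d : ℕ} (a : Fin n → Fin d → ι) (X : Fin n → Fin d → 𝒳) : ℝ :=
  ∏ i, ∏ j, f (a i j) (X i j)

/-- The mixture likelihood ratio with the likelihood replaced by the finite-rank kernel
`∑ t, c t * f t x * f t y`. -/
noncomputable def finiteRankRatio (c : ι → ℝ) (f : ι → 𝒳 → ℝ) (n d : ℕ)
    (z : DatabasePair.Data 𝒳 n d) : ℝ :=
  (n.factorial : ℝ)⁻¹ * ∑ σ : Equiv.Perm (Fin n),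
    ∏ i, ∏ j, ∑ t, c t * (f t (z.1 i j) * f t (z.2 (σ i) j))

variable {f : ι → 𝒳 → ℝ} {n d : ℕ}

omit [Fintype ι] [DecidableEq ι] in
theorem integrable_arrayFun_mul (hf : ∀ t, MemLp (f t) 2 Q) (a b : Fin n → Fin d → ι) :
    Integrable (fun X => arrayFun f a X * arrayFun f b X)
      (Measure.pi fun _ : Fin n => Measure.pi fun _ : Fin d => Q) := by
  simp only [arrayFun, ← Finset.prod_mul_distrib]
  exact Integrable.fintype_prod fun i => Integrable.fintype_prod fun j =>
    (hf (a i j)).integrable_mul (hf (b i j))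

omit [Fintype ι] in
theorem integral_arrayFun_mul (hon : ∀ s t, ∫ x, f s x * f t x ∂Q = if s = t then 1 else 0)
    (a b : Fin n → Fin d → ι) :
    ∫ X, arrayFun f a X * arrayFun f b X
      ∂(Measure.pi fun _ : Fin n => Measure.pi fun _ : Fin d => Q) = if a = b then 1 else 0 := by
  simp only [arrayFun, ← Finset.prod_mul_distrib]
  rw [integral_fintype_prod_eq_prod (f := fun i (x : Fin d → 𝒳) =>
    ∏ j, f (a i j) (x j) * f (b i j) (x j))]
  have h1 : ∀ i, ∫ x, ∏ j, f (a i j) (x j) * f (b i j) (x j) ∂(Measure.pi fun _ : Fin d => Q) =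
      ∏ j, if a i j = b i j then 1 else 0 := by
    intro i
    rw [integral_fintype_prod_eq_prod (f := fun j x => f (a i j) x * f (b i j) x)]
    simp only [hon]
  simp only [h1]
  by_cases hab : a = b
  · simp [hab]
  · rw [if_neg hab]
    have : ∃ i j, a i j ≠ b i j := by
      by_contra! h
      exact hab (funext fun i => funext fun j => h i j)
    obtain ⟨i, j, hij⟩ := this
    exact Finset.prod_eq_zero (Finset.mem_univ i)
      (Finset.prod_eq_zero (Finset.mem_univ j) (if_neg hij))

omit [MeasurableSpace 𝒳] [DecidableEq ι] in
theorem finiteRankRatio_eq_sum (c : ι → ℝ) (z : DatabasePair.Data 𝒳 n d) :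
    finiteRankRatio c f n d z = ∑ p : Equiv.Perm (Fin n) × (Fin n → Fin d → ι),
      ((n.factorial : ℝ)⁻¹ * ∏ i, ∏ j, c (p.2 i j)) *
        (arrayFun f p.2 z.1 * arrayFun f (p.2 ∘ p.1.symm) z.2) := by
  classical
  rw [finiteRankRatio, Fintype.sum_prod_type, Finset.mul_sum]
  refine Finset.sum_congr rfl fun σ _ => ?_
  have h1 : ∏ i, ∏ j, ∑ t, c t * (f t (z.1 i j) * f t (z.2 (σ i) j)) =
      ∑ a : Fin n → Fin d → ι, ∏ i, ∏ j,
        c (a i j) * (f (a i j) (z.1 i j) * f (a i j) (z.2 (σ i) j)) := by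
    have h2 : ∀ i, ∏ j, ∑ t, c t * (f t (z.1 i j) * f t (z.2 (σ i) j)) =
        ∑ m : Fin d → ι, ∏ j, c (m j) * (f (m j) (z.1 i j) * f (m j) (z.2 (σ i) j)) := by
      intro i
      have := Finset.prod_univ_sum (fun _ : Fin d => (Finset.univ : Finset ι))
        fun j t => c t * (f t (z.1 i j) * f t (z.2 (σ i) j))
      simpa using this
    simp only [h2]
    have := Finset.prod_univ_sum (fun _ : Fin n => (Finset.univ : Finset (Fin d → ι)))
      fun i m => ∏ j, c (m j) * (f (m j) (z.1 i j) * f (m j) (z.2 (σ i) j))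
    simpa using this
  rw [h1, Finset.mul_sum]
  refine Finset.sum_congr rfl fun a _ => ?_
  have h3 : arrayFun f (a ∘ σ.symm) z.2 = ∏ i, ∏ j, f (a i j) (z.2 (σ i) j) := by
    rw [arrayFun, ← Equiv.prod_comp σ]
    simp
  rw [h3, arrayFun]
  simp only [Finset.prod_mul_distrib]
  ring

/-- By orthonormality, only pairs of permutations and words giving the same arrays on both sides
contribute to the second moment. -/
theorem integral_finiteRankRatio_sq (hf : ∀ t, MemLp (f t) 2 Q)
    (hon : ∀ s t, ∫ x, f s x * f t x ∂Q = if s = t then 1 else 0) (c : ι → ℝ) :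
    Integrable (fun z => finiteRankRatio c f n d z ^ 2)
      ((Measure.pi fun _ : Fin n => Measure.pi fun _ : Fin d => Q).prod
        (Measure.pi fun _ : Fin n => Measure.pi fun _ : Fin d => Q)) ∧
    ∫ z, finiteRankRatio c f n d z ^ 2
      ∂((Measure.pi fun _ : Fin n => Measure.pi fun _ : Fin d => Q).prod
        (Measure.pi fun _ : Fin n => Measure.pi fun _ : Fin d => Q)) =
    (n.factorial : ℝ)⁻¹ * ∑ a : Fin n → Fin d → ι, (∏ i, ∏ j, c (a i j) ^ 2) *
      ((Finset.univ.filter fun σ : Equiv.Perm (Fin n) => a ∘ σ = a).card : ℝ) := by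
  classical
  set μ := Measure.pi fun _ : Fin n => Measure.pi fun _ : Fin d => Q with hμ
  set C : (Fin n → Fin d → ι) → ℝ := fun a => (n.factorial : ℝ)⁻¹ * ∏ i, ∏ j, c (a i j) with hC
  have hexp : ∀ z : DatabasePair.Data 𝒳 n d, finiteRankRatio c f n d z ^ 2 =
      ∑ p : Equiv.Perm (Fin n) × (Fin n → Fin d → ι),
      ∑ q : Equiv.Perm (Fin n) × (Fin n → Fin d → ι), (C p.2 * C q.2) *
        ((arrayFun f p.2 z.1 * arrayFun f q.2 z.1) *
          (arrayFun f (p.2 ∘ p.1.symm) z.2 * arrayFun f (q.2 ∘ q.1.symm) z.2)) := by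
    intro z
    rw [finiteRankRatio_eq_sum, sq, Finset.sum_mul_sum]
    refine Finset.sum_congr rfl fun p _ => Finset.sum_congr rfl fun q _ => ?_
    ring
  have hint : ∀ p q : Equiv.Perm (Fin n) × (Fin n → Fin d → ι),
      Integrable (fun z : DatabasePair.Data 𝒳 n d => (C p.2 * C q.2) *
        ((arrayFun f p.2 z.1 * arrayFun f q.2 z.1) *
          (arrayFun f (p.2 ∘ p.1.symm) z.2 * arrayFun f (q.2 ∘ q.1.symm) z.2))) (μ.prod μ) :=
    fun p q => ((integrable_arrayFun_mul hf _ _).mul_prod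
      (integrable_arrayFun_mul hf _ _)).const_mul _
  simp only [hexp]
  refine ⟨integrable_finsetSum _ fun p _ => integrable_finsetSum _ fun q _ => hint p q, ?_⟩
  rw [integral_finsetSum _ fun p _ => integrable_finsetSum _ fun q _ => hint p q]
  have hval : ∀ p q : Equiv.Perm (Fin n) × (Fin n → Fin d → ι),
      ∫ z : DatabasePair.Data 𝒳 n d, (C p.2 * C q.2) *
        ((arrayFun f p.2 z.1 * arrayFun f q.2 z.1) *
          (arrayFun f (p.2 ∘ p.1.symm) z.2 * arrayFun f (q.2 ∘ q.1.symm) z.2)) ∂(μ.prod μ) =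
      (C p.2 * C q.2) * ((if p.2 = q.2 then 1 else 0) *
        (if p.2 ∘ p.1.symm = q.2 ∘ q.1.symm then 1 else 0)) := by
    intro p q
    rw [integral_const_mul, integral_prod_mul (fun X => arrayFun f p.2 X * arrayFun f q.2 X)
      (fun X => arrayFun f (p.2 ∘ p.1.symm) X * arrayFun f (q.2 ∘ q.1.symm) X),
      integral_arrayFun_mul hon, integral_arrayFun_mul hon]
  have hsum : ∀ p : Equiv.Perm (Fin n) × (Fin n → Fin d → ι),
      ∫ z : DatabasePair.Data 𝒳 n d, ∑ q : Equiv.Perm (Fin n) × (Fin n → Fin d → ι),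
        (C p.2 * C q.2) * ((arrayFun f p.2 z.1 * arrayFun f q.2 z.1) *
          (arrayFun f (p.2 ∘ p.1.symm) z.2 * arrayFun f (q.2 ∘ q.1.symm) z.2)) ∂(μ.prod μ) =
      C p.2 ^ 2 * ((Finset.univ.filter fun σ : Equiv.Perm (Fin n) => p.2 ∘ σ = p.2).card : ℝ) := by
    rintro ⟨σ, a⟩
    rw [integral_finsetSum _ fun q _ => hint _ q]
    rw [Finset.sum_congr rfl fun q _ => hval (σ, a) q, Fintype.sum_prod_type]
    have h1 : ∀ τ : Equiv.Perm (Fin n), ∑ b : Fin n → Fin d → ι, C a * C b *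
        ((if a = b then 1 else 0) * (if a ∘ σ.symm = b ∘ τ.symm then 1 else 0)) =
        C a ^ 2 * if a ∘ (σ.symm * τ : Equiv.Perm (Fin n)) = a then 1 else 0 := by
      intro τ
      rw [Finset.sum_eq_single a]
      · have h2 : a ∘ σ.symm = a ∘ τ.symm ↔ a ∘ (σ.symm * τ : Equiv.Perm (Fin n)) = a := by
          constructor
          · intro h
            funext i
            have := congrFun h (τ i)
            simpa using this
          · intro h
            funext i
            have := congrFun h (τ.symm i)
            simpa using this
        simp only [h2, if_true, one_mul, sq]
      · intro b _ hb
        simp [Ne.symm hb]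
      · simp
    refine (Finset.sum_congr rfl fun τ _ => h1 τ).trans ?_
    have hshift : (∑ τ : Equiv.Perm (Fin n),
        if a ∘ (σ.symm * τ : Equiv.Perm (Fin n)) = a then (1 : ℝ) else 0) =
        ((Finset.univ.filter fun σ : Equiv.Perm (Fin n) => a ∘ σ = a).card : ℝ) :=
      (Equiv.sum_comp (Equiv.mulLeft (σ.symm : Equiv.Perm (Fin n)))
        (fun τ : Equiv.Perm (Fin n) => if a ∘ τ = a then (1 : ℝ) else 0)).trans
        (Finset.sum_boole _ _)
    rw [← Finset.mul_sum, hshift]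
  rw [Finset.sum_congr rfl fun p _ => hsum p, Fintype.sum_prod_type]
  refine (Finset.sum_congr rfl fun σ _ => (rfl : _ = ∑ a : Fin n → Fin d → ι, C a ^ 2 *
    ((Finset.univ.filter fun σ : Equiv.Perm (Fin n) => a ∘ σ = a).card : ℝ))).trans ?_
  rw [Finset.sum_const, Finset.card_univ, Fintype.card_perm,
    Fintype.card_fin, nsmul_eq_mul, Finset.mul_sum, Finset.mul_sum]
  refine Finset.sum_congr rfl fun a _ => ?_
  have hn : (n.factorial : ℝ) ≠ 0 := by positivity
  simp only [hC, mul_pow, Finset.prod_pow]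
  field_simp

end FiniteRank

/-! ### Bounds on the second moment -/

namespace DatabasePair

variable {𝒳 : Type*} [MeasurableSpace 𝒳] (D : DatabasePair 𝒳) (n d : ℕ)

theorem measurePreserving_entries (i l : Fin n) (j : Fin d) :
    MeasurePreserving (fun z : Data 𝒳 n d => (z.1 i j, z.2 l j)) (D.null n d)
      (D.Q.prod D.Q) := by
  have h : ∀ i : Fin n, MeasurePreserving (fun X : Fin n → Fin d → 𝒳 => X i j)
      (Measure.pi fun _ : Fin n => Measure.pi fun _ : Fin d => D.Q) D.Q := fun i =>
    (measurePreserving_eval (fun _ : Fin d => D.Q) j).comp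
      (measurePreserving_eval (fun _ : Fin n => Measure.pi fun _ : Fin d => D.Q) i)
  exact (h i).prod (h l)

theorem mixtureDensity_ae_eq : ∀ᵐ z ∂(D.null n d), D.mixtureDensity n d z =
    ENNReal.ofReal ((n.factorial : ℝ)⁻¹ * ∑ σ : Equiv.Perm (Fin n),
      ∏ i, ∏ j, D.likelihood (z.1 i j) (z.2 (σ i) j)) := by
  have hfin : ∀ᵐ z ∂(D.null n d), ∀ i l j,
      D.P.rnDeriv (D.Q.prod D.Q) (z.1 i j, z.2 l j) < ∞ := by
    simp only [ae_all_iff]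
    intro i l j
    exact (D.measurePreserving_entries n d i l j).quasiMeasurePreserving.ae
      (Measure.rnDeriv_lt_top D.P (D.Q.prod D.Q))
  filter_upwards [hfin] with z hz
  have hnn : ∀ x y, 0 ≤ D.likelihood x y := fun x y => ENNReal.toReal_nonneg
  have h1 : ∀ σ : Equiv.Perm (Fin n), D.altDensity n d σ z =
      ENNReal.ofReal (∏ i, ∏ j, D.likelihood (z.1 i j) (z.2 (σ i) j)) := by
    intro σ
    rw [ENNReal.ofReal_prod_of_nonneg fun i _ => Finset.prod_nonneg fun j _ => hnn _ _, altDensity]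
    refine Finset.prod_congr rfl fun i _ => ?_
    rw [ENNReal.ofReal_prod_of_nonneg fun j _ => hnn _ _]
    refine Finset.prod_congr rfl fun j _ => ?_
    rw [likelihood, ENNReal.ofReal_toReal (hz _ _ _).ne]
  rw [mixtureDensity, ENNReal.ofReal_mul (by positivity),
    ENNReal.ofReal_inv_of_pos (by positivity), ENNReal.ofReal_natCast,
    ENNReal.ofReal_sum_of_nonneg fun σ _ =>
      Finset.prod_nonneg fun i _ => Finset.prod_nonneg fun j _ => hnn _ _,
    Fintype.card_perm, Fintype.card_fin]
  simp only [h1]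

/-- By Fatou's lemma along a subsequence of the eigenfunction expansion which converges almost
everywhere, bounds for the finite-rank truncations pass to the second moment. -/
theorem secondMoment_le_of_truncations {lam : ℕ → ℝ} (hlam : D.IsEigenvalueSeq lam) {B : ℝ}
    (hB : ∀ s : Finset ℕ, (∀ i ∈ s, lam i ≠ 0) →
      (n.factorial : ℝ)⁻¹ * ∑ a : Fin n → Fin d → s, (∏ i, ∏ j, lam (a i j) ^ 2) *
        ((Finset.univ.filter fun σ : Equiv.Perm (Fin n) => a ∘ σ = a).card : ℝ) ≤ B) :
    D.secondMoment n d ≤ ENNReal.ofReal B := by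
  obtain ⟨-, -, f, hfm, hf2, hon, N, hN⟩ := D.exists_likelihood_eigenexpansion hlam
  set s : ℕ → Finset ℕ := fun m => (Finset.range (N m)).filter fun i => lam i ≠ 0 with hs
  set G : ℕ → Data 𝒳 n d → ℝ := fun m =>
    finiteRankRatio (fun t : s m => lam t) (fun t => f t) n d with hG
  have hGm : ∀ m, Measurable (G m) := by
    intro m
    refine (Finset.measurable_fun_sum _ fun σ _ => Finset.measurable_fun_prod _ fun i _ =>
      Finset.measurable_fun_prod _ fun j _ => Finset.measurable_fun_sum _ fun t _ => ?_).const_mul _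
    exact (((hfm t).comp (by fun_prop)).mul ((hfm t).comp (by fun_prop))).const_mul _
  have hGint : ∀ m, ∫⁻ z, ENNReal.ofReal (G m z ^ 2) ∂(D.null n d) ≤ ENNReal.ofReal B := by
    intro m
    have hne : ∀ t : s m, lam t ≠ 0 := fun t => (Finset.mem_filter.1 t.2).2
    obtain ⟨h1, h2⟩ := integral_finiteRankRatio_sq (Q := D.Q) (n := n) (d := d)
      (f := fun t : s m => f t) (fun t => hf2 t)
      (fun t u => by rw [hon _ _ (hne t) (hne u)]; simp only [Subtype.ext_iff])
      (fun t : s m => lam t)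
    refine (ofReal_integral_eq_lintegral_ofReal h1
      (Eventually.of_forall fun z => sq_nonneg _)).symm.trans_le
      (ENNReal.ofReal_le_ofReal (h2.trans_le ?_))
    exact hB (s m) fun i hi => hne ⟨i, hi⟩
  have hlim : ∀ᵐ z ∂(D.null n d), Tendsto (fun m => ENNReal.ofReal (G m z ^ 2)) atTop
      (𝓝 (D.mixtureDensity n d z ^ 2)) := by
    have hent : ∀ᵐ z ∂(D.null n d), ∀ i l j, Tendsto (fun m => ∑ t ∈ Finset.range (N m),
        lam t * (f t (z.1 i j) * f t (z.2 l j))) atTop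
        (𝓝 (D.likelihood (z.1 i j) (z.2 l j))) := by
      simp only [ae_all_iff]
      intro i l j
      exact (D.measurePreserving_entries n d i l j).quasiMeasurePreserving.ae hN
    filter_upwards [hent, D.mixtureDensity_ae_eq n d] with z hz hmix
    have hsum : ∀ m x y, ∑ t : s m, lam t * (f t x * f t y) =
        ∑ t ∈ Finset.range (N m), lam t * (f t x * f t y) := by
      intro m x y
      rw [Finset.sum_coe_sort (s m) fun t => lam t * (f t x * f t y), hs]
      refine Finset.sum_filter_of_ne fun t _ ht h0 => ht ?_
      rw [h0, zero_mul]
    rw [hmix, ← ENNReal.ofReal_pow]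
    · refine ENNReal.tendsto_ofReal (Tendsto.pow ?_ 2)
      simp only [hG, finiteRankRatio, hsum]
      exact (tendsto_finsetSum _ fun σ _ => tendsto_finsetProd _ fun i _ =>
        tendsto_finsetProd _ fun j _ => hz i (σ i) j).const_mul _
    · exact mul_nonneg (by positivity) (Finset.sum_nonneg fun σ _ => Finset.prod_nonneg
        fun i _ => Finset.prod_nonneg fun j _ => ENNReal.toReal_nonneg)
  calc D.secondMoment n d = ∫⁻ z, liminf (fun m => ENNReal.ofReal (G m z ^ 2)) atTop
        ∂(D.null n d) := by
        rw [secondMoment_eq]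
        refine lintegral_congr_ae ?_
        filter_upwards [hlim] with z hz
        exact hz.liminf_eq.symm
    _ ≤ liminf (fun m => ∫⁻ z, ENNReal.ofReal (G m z ^ 2) ∂(D.null n d)) atTop :=
        lintegral_liminf_le fun m => ((hGm m).pow_const 2).ennreal_ofReal
    _ ≤ ENNReal.ofReal B :=
        (liminf_le_liminf (Eventually.of_forall hGint)).trans_eq (liminf_const _)

/-- Every single second moment is finite, also when `λ₁² = 1`: it is at most `(∑ λᵢ²) ^ (d n)`. -/
theorem secondMoment_lt_top {lam : ℕ → ℝ} (hlam : D.IsEigenvalueSeq lam) :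
    D.secondMoment n d < ∞ := by
  have hsq := (D.exists_likelihood_eigenexpansion hlam).1
  refine (D.secondMoment_le_of_truncations n d hlam
    (B := ((∑' i, lam i ^ 2) ^ d) ^ n) fun s _ => ?_).trans_lt ENNReal.ofReal_lt_top
  have hexp : ∑ a : Fin n → Fin d → s, (∏ i, ∏ j, lam (a i j) ^ 2) =
      ((∑ t : s, lam t ^ 2) ^ d) ^ n := by
    have h1 := Finset.prod_univ_sum (fun _ : Fin d => (Finset.univ : Finset s))
      fun _ t => lam t ^ 2
    have h2 := Finset.prod_univ_sum (fun _ : Fin n => (Finset.univ : Finset (Fin d → s)))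
      fun _ m => ∏ j, lam (m j) ^ 2
    simp only [Finset.prod_const, Finset.card_univ, Fintype.card_fin,
      Fintype.piFinset_univ] at h1 h2
    rw [h1, h2]
  calc (n.factorial : ℝ)⁻¹ * ∑ a : Fin n → Fin d → s, (∏ i, ∏ j, lam (a i j) ^ 2) *
        ((Finset.univ.filter fun σ : Equiv.Perm (Fin n) => a ∘ σ = a).card : ℝ)
      ≤ (n.factorial : ℝ)⁻¹ * ∑ a : Fin n → Fin d → s,
        (∏ i, ∏ j, lam (a i j) ^ 2) * (n.factorial : ℝ) := by
        refine mul_le_mul_of_nonneg_left (Finset.sum_le_sum fun a _ =>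
          mul_le_mul_of_nonneg_left ?_ ?_) (by positivity)
        · have := Finset.card_le_univ
            (Finset.univ.filter fun σ : Equiv.Perm (Fin n) => a ∘ σ = a)
          rw [Fintype.card_perm, Fintype.card_fin] at this
          exact_mod_cast this
        · exact Finset.prod_nonneg fun i _ => Finset.prod_nonneg fun j _ => sq_nonneg _
    _ = ((∑ t : s, lam t ^ 2) ^ d) ^ n := by
        rw [← Finset.sum_mul, hexp]
        field_simp
    _ ≤ ((∑' i, lam i ^ 2) ^ d) ^ n := by
        have : ∑ t : s, lam t ^ 2 ≤ ∑' i, lam i ^ 2 := by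
          rw [Finset.sum_coe_sort s fun t => lam t ^ 2]
          exact hsq.sum_le_tsum _ fun i _ => sq_nonneg _
        have h0 : 0 ≤ ∑ t : s, lam t ^ 2 := Finset.sum_nonneg fun t _ => sq_nonneg _
        gcongr

/-- The quantitative bound behind all regimes: with `S` bounding `∑_{i ≥ 1} λᵢ²`, the second moment
is at most `exp ((1 + S) ^ d / (1 - λ₁²))`, uniformly in `n`. -/
theorem secondMoment_le_exp {lam : ℕ → ℝ} (hlam : D.IsEigenvalueSeq lam)
    (h1 : lam 1 ^ 2 < 1) {S : ℝ}
    (hS : ∀ s : Finset ℕ, ∑ i ∈ s, lam (i + 1) ^ 2 ≤ S) :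
    D.secondMoment n d ≤ ENNReal.ofReal (Real.exp ((1 + S) ^ d / (1 - lam 1 ^ 2))) := by
  have hle := (D.exists_likelihood_eigenexpansion hlam).2.1
  have hle' : ∀ i, lam i ^ 2 ≤ 1 := fun i => (sq_le_one_iff_abs_le_one _).2 (hle i)
  have hmono : ∀ i, 1 ≤ i → lam i ^ 2 ≤ lam 1 ^ 2 := fun i hi => sq_le_sq.2 (hlam.1 hi)
  refine D.secondMoment_le_of_truncations n d hlam fun s _ => ?_
  -- `λ₀`, of modulus at most one, is the only eigenvalue that may exceed `λ₁` in modulus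
  have hex : ∀ i : s, lam 1 ^ 2 < lam i ^ 2 → (i : ℕ) = 0 := by
    intro i hi
    by_contra h0
    exact absurd (hmono i (Nat.one_le_iff_ne_zero.2 h0)) (not_le.2 hi)
  have hmain := sum_array_stabilizer_le n d (fun t : s => lam t ^ 2) (fun t => sq_nonneg _)
    (fun t => hle' t) h1 fun t u ht hu => Subtype.ext ((hex t ht).trans (hex u hu).symm)
  have hsum : ∑ t : s, lam t ^ 2 ≤ 1 + S := by
    rw [Finset.sum_coe_sort s fun t => lam t ^ 2]
    obtain ⟨N, hN⟩ := s.exists_nat_subset_range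
    calc ∑ i ∈ s, lam i ^ 2 ≤ ∑ i ∈ Finset.range (N + 1), lam i ^ 2 :=
          Finset.sum_le_sum_of_subset_of_nonneg
            (hN.trans (Finset.range_subset_range.2 (Nat.le_succ N))) fun i _ _ => sq_nonneg _
      _ = ∑ i ∈ Finset.range N, lam (i + 1) ^ 2 + lam 0 ^ 2 := Finset.sum_range_succ' _ _
      _ ≤ 1 + S := by linarith [hS (Finset.range N), hle' 0]
  have hpos : 0 < 1 - lam 1 ^ 2 := by linarith
  have h0 : 0 ≤ ∑ t : s, lam t ^ 2 := Finset.sum_nonneg fun t _ => sq_nonneg _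
  rw [inv_mul_le_iff₀ (by positivity)]
  refine hmain.trans (mul_le_mul_of_nonneg_left (Real.exp_le_exp.2 ?_) (by positivity))
  gcongr

/-- When `∑_{i ≥ 1} λᵢ² / (1 - λᵢ²) ≤ C / d`, the second moment is bounded in terms of `C` only. -/
theorem secondMoment_le_of_eigenvalueSum_le {lam : ℕ → ℝ} (hlam : D.IsEigenvalueSeq lam)
    (hd : 1 ≤ d) {C : ℝ} (hC : 0 ≤ C) (hsum : eigenvalueSum lam ≤ ENNReal.ofReal (C / d)) :
    D.secondMoment n d ≤ ENNReal.ofReal (Real.exp (Real.exp C * (1 + C))) := by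
  have hd' : (1 : ℝ) ≤ d := by exact_mod_cast hd
  have hCd : 0 ≤ C / d := by positivity
  have hterm : ∀ i, ENNReal.ofReal (lam (i + 1) ^ 2) / ENNReal.ofReal (1 - lam (i + 1) ^ 2) ≤
      ENNReal.ofReal (C / d) := fun i => (ENNReal.le_tsum i).trans hsum
  have hlt : ∀ i, lam (i + 1) ^ 2 < 1 := by
    intro i
    by_contra! h
    have := hterm i
    rw [ENNReal.ofReal_of_nonpos (by linarith : 1 - lam (i + 1) ^ 2 ≤ 0), ENNReal.div_zero
      (ENNReal.ofReal_pos.2 (by linarith)).ne', top_le_iff] at this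
    exact ENNReal.ofReal_ne_top this
  have hdiv : ∀ i, ENNReal.ofReal (lam (i + 1) ^ 2) / ENNReal.ofReal (1 - lam (i + 1) ^ 2) =
      ENNReal.ofReal (lam (i + 1) ^ 2 / (1 - lam (i + 1) ^ 2)) := fun i =>
    (ENNReal.ofReal_div_of_pos (by linarith [hlt i])).symm
  have hS : ∀ s : Finset ℕ, ∑ i ∈ s, lam (i + 1) ^ 2 ≤ C / d := by
    intro s
    rw [← ENNReal.ofReal_le_ofReal_iff hCd, ENNReal.ofReal_sum_of_nonneg fun i _ => sq_nonneg _]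
    refine le_trans (Finset.sum_le_sum fun i _ => ?_) ((ENNReal.sum_le_tsum s).trans hsum)
    rw [hdiv]
    refine ENNReal.ofReal_le_ofReal (le_div_self (sq_nonneg _) (by linarith [hlt i]) ?_)
    linarith [sq_nonneg (lam (i + 1))]
  have h1 : lam 1 ^ 2 < 1 := hlt 0
  have hpos : 0 < 1 - lam 1 ^ 2 := by linarith
  refine (D.secondMoment_le_exp n d hlam h1 hS).trans
    (ENNReal.ofReal_le_ofReal (Real.exp_le_exp.2 ?_))
  have hq : (1 - lam 1 ^ 2)⁻¹ ≤ 1 + C := by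
    have h2 := hterm 0
    rw [hdiv, ENNReal.ofReal_le_ofReal_iff hCd, zero_add] at h2
    have h3 : (1 - lam 1 ^ 2)⁻¹ = 1 + lam 1 ^ 2 / (1 - lam 1 ^ 2) := by field_simp; ring
    have h4 : C / d ≤ C := div_le_self hC hd'
    linarith
  have hpow : (1 + C / d) ^ d ≤ Real.exp C := by
    calc (1 + C / d) ^ d ≤ Real.exp (C / d) ^ d := by
          refine pow_le_pow_left₀ (by linarith) ?_ d
          rw [add_comm]
          exact Real.add_one_le_exp _
      _ = Real.exp C := by
          rw [← Real.exp_nat_mul, mul_div_cancel₀ _ (by linarith)]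
  rw [div_eq_mul_inv]
  exact mul_le_mul hpow hq (inv_nonneg.2 hpos.le) (Real.exp_pos _).le

/-! ### Risk lower bound -/

instance isProbabilityMeasure_alt (σ : Equiv.Perm (Fin n)) :
    IsProbabilityMeasure (D.alt n d σ) := by
  refine Measure.isProbabilityMeasure_map (Measurable.aemeasurable ?_)
  fun_prop

/-- A bounded second moment keeps the risk of every test away from zero: the mixture gives little
mass to sets of small null probability, by the pointwise bound `ρ ≤ K + ρ² / K`. -/
theorem le_minimaxRisk {K : ℝ≥0} (hK : 1 ≤ K) (hM : D.secondMoment n d ≤ K / 4) :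
    (1 - 1 / 4) / (K : ℝ≥0∞) ≤ D.minimaxRisk n d := by
  have hK0 : (K : ℝ≥0∞) ≠ 0 := by
    have : (0 : ℝ≥0) < K := lt_of_lt_of_le one_pos hK
    exact_mod_cast this.ne'
  refine le_iInf₂ fun φ hφ => ENNReal.div_le_of_le_mul' (tsub_le_iff_right.2 ?_)
  set A : Set (Data 𝒳 n d) := {z | φ z = 1} with hA
  have hAm : MeasurableSet A := hφ (measurableSet_singleton 1)
  have hAc : {z | φ z = 0} = Aᶜ := by
    ext z
    simp only [hA, Set.mem_ofPred_eq, Set.mem_compl_iff]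
    omega
  set S : ℝ≥0∞ := ⨆ σ : Equiv.Perm (Fin n), D.alt n d σ Aᶜ with hS
  have hcard0 : (Fintype.card (Equiv.Perm (Fin n)) : ℝ≥0∞) ≠ 0 := by
    exact_mod_cast Fintype.card_ne_zero
  have hcard : (Fintype.card (Equiv.Perm (Fin n)) : ℝ≥0∞) ≠ ∞ := ENNReal.natCast_ne_top _
  have hmix : ∀ B, D.mixture n d B = (Fintype.card (Equiv.Perm (Fin n)) : ℝ≥0∞)⁻¹ *
      ∑ σ, D.alt n d σ B := by
    intro B
    rw [mixture, Measure.smul_apply, Measure.finsetSum_apply, smul_eq_mul]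
  have hone : D.mixture n d Set.univ = 1 := by
    rw [hmix]
    simp only [measure_univ, Finset.sum_const, Finset.card_univ, nsmul_eq_mul, mul_one]
    exact ENNReal.inv_mul_cancel hcard0 hcard
  have hcompl : D.mixture n d Aᶜ ≤ S := by
    rw [hmix]
    calc _ ≤ (Fintype.card (Equiv.Perm (Fin n)) : ℝ≥0∞)⁻¹ * ∑ _σ : Equiv.Perm (Fin n), S := by
          gcongr with σ
          exact le_iSup (fun σ => D.alt n d σ Aᶜ) σ
      _ = S := by
          rw [Finset.sum_const, Finset.card_univ, nsmul_eq_mul, ← mul_assoc,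
            ENNReal.inv_mul_cancel hcard0 hcard, one_mul]
  have hpt : ∀ ρ : ℝ≥0∞, ρ ≤ K + (K : ℝ≥0∞)⁻¹ * ρ ^ 2 := by
    intro ρ
    rcases le_total ρ K with h | h
    · exact h.trans le_self_add
    · refine le_trans ?_ le_add_self
      calc ρ = (K : ℝ≥0∞)⁻¹ * K * ρ := by
            rw [ENNReal.inv_mul_cancel hK0 ENNReal.coe_ne_top, one_mul]
        _ ≤ (K : ℝ≥0∞)⁻¹ * ρ * ρ := by gcongr
        _ = _ := by rw [mul_assoc, sq]
  have hmass : D.mixture n d A ≤ K * D.null n d A + 1 / 4 := by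
    rw [mixture_eq_withDensity, withDensity_apply _ hAm]
    calc ∫⁻ z in A, D.mixtureDensity n d z ∂(D.null n d)
        ≤ ∫⁻ z in A, (K + (K : ℝ≥0∞)⁻¹ * D.mixtureDensity n d z ^ 2) ∂(D.null n d) :=
          lintegral_mono fun z => hpt _
      _ = K * D.null n d A +
          (K : ℝ≥0∞)⁻¹ * ∫⁻ z in A, D.mixtureDensity n d z ^ 2 ∂(D.null n d) := by
          rw [lintegral_add_left measurable_const, setLIntegral_const,
            lintegral_const_mul _ ((D.measurable_mixtureDensity n d).pow_const 2)]
      _ ≤ K * D.null n d A + (K : ℝ≥0∞)⁻¹ * (K / 4) := by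
          gcongr
          exact (setLIntegral_le_lintegral _ _).trans ((D.secondMoment_eq n d).symm.trans_le hM)
      _ = K * D.null n d A + 1 / 4 := by
          rw [← mul_div_assoc, ENNReal.inv_mul_cancel hK0 ENNReal.coe_ne_top]
  have hK1 : (1 : ℝ≥0∞) ≤ K := by exact_mod_cast hK
  calc (1 : ℝ≥0∞) = D.mixture n d A + D.mixture n d Aᶜ := by
        rw [measure_add_measure_compl hAm, hone]
    _ ≤ (K * D.null n d A + 1 / 4) + K * S :=
        add_le_add hmass (hcompl.trans (le_mul_of_one_le_left' hK1))
    _ = K * D.risk n d φ + 1 / 4 := by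
        rw [risk, hAc]
        ring

end DatabasePair

/-- Uniformly bounded second moments rule out strong detection. -/
theorem not_admissibleStrong_of_secondMoment_le {𝒳 : ℕ → Type*} [∀ k, MeasurableSpace (𝒳 k)]
    (D : ∀ k, DatabasePair (𝒳 k)) (d n : ℕ → ℕ) {C : ℝ≥0}
    (hC : ∀ k, (D k).secondMoment (n k) (d k) ≤ C) : ¬ AdmissibleStrong D d n := by
  intro hadm
  set K : ℝ≥0 := 4 * C + 1 with hK
  have hK1 : 1 ≤ K := le_add_self
  have hb : ∀ k, (1 - 1 / 4) / (K : ℝ≥0∞) ≤ (D k).minimaxRisk (n k) (d k) := by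
    intro k
    refine (D k).le_minimaxRisk _ _ hK1 ((hC k).trans ?_)
    rw [ENNReal.le_div_iff_mul_le (by simp) (by simp)]
    have : C * 4 ≤ K := by rw [hK, mul_comm]; exact le_self_add
    exact_mod_cast this
  have h0 := ge_of_tendsto' hadm hb
  rw [nonpos_iff_eq_zero, ENNReal.div_eq_zero_iff, tsub_eq_zero_iff_le] at h0
  rcases h0 with h0 | h0
  · rw [one_div, ENNReal.one_le_inv] at h0
    norm_num at h0
  · exact ENNReal.coe_ne_top h0

theorem exists_bound_of_eventually_le {u : ℕ → ℝ≥0∞} (hu : ∀ k, u k < ∞) {B : ℝ≥0∞} (hB : B ≠ ∞)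
    (h : ∀ᶠ k in atTop, u k ≤ B) : ∃ C : ℝ≥0, ∀ k, u k ≤ C := by
  obtain ⟨k₀, hk₀⟩ := eventually_atTop.1 h
  have hfin : (∑ k ∈ Finset.range k₀, u k) + B ≠ ∞ :=
    ENNReal.add_ne_top.2 ⟨(ENNReal.sum_lt_top.2 fun k _ => hu k).ne, hB⟩
  refine ⟨((∑ k ∈ Finset.range k₀, u k) + B).toNNReal, fun k => ?_⟩
  rw [ENNReal.coe_toNNReal hfin]
  rcases lt_or_ge k k₀ with hk | hk
  · exact (Finset.single_le_sum (f := u) (fun _ _ => zero_le) (Finset.mem_range.2 hk)).trans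
      le_self_add
  · exact (hk₀ k hk).trans le_add_self

/-- The threshold in the regime of constant `d` can only hold if `λ₁² < 1` and `∑ λᵢ²` converges;
otherwise the right-hand side is nonpositive (for a divergent series, because its `tsum` and the
logarithm of that vanish). -/
theorem sq_lt_one_and_summable_of_threshold {lam : ℕ → ℝ} {d : ℕ}
    (h : (d : ℝ) < -(Real.log (lam 1 ^ 2) / Real.log (∑' i, lam i ^ 2))) :
    lam 1 ^ 2 < 1 ∧ Summable fun i => lam i ^ 2 := by
  have hd : (0 : ℝ) ≤ d := Nat.cast_nonneg d
  have hsum : Summable fun i => lam i ^ 2 := by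
    by_contra hns
    rw [tsum_eq_zero_of_not_summable hns, Real.log_zero, div_zero, neg_zero] at h
    linarith
  refine ⟨?_, hsum⟩
  by_contra! h1
  have h2 : 1 ≤ ∑' i, lam i ^ 2 := h1.trans (hsum.le_tsum 1 fun i _ => sq_nonneg _)
  have := div_nonneg (Real.log_nonneg h1) (Real.log_nonneg h2)
  linarith

theorem theorem2 {𝒳 : ℕ → Type*} [∀ k, MeasurableSpace (𝒳 k)]
    (D : ∀ k, DatabasePair (𝒳 k)) (d n : ℕ → ℕ)
    (lam : ℕ → ℕ → ℝ) (hlam : ∀ k, (D k).IsEigenvalueSeq (lam k))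
    (h :
      -- `d` and the `λ_i`, `i ≥ 1`, are constant, and `n → ∞`
      ((∀ k, d k = d 0) ∧ (∀ k, ∀ i ≥ 1, lam k i = lam 0 i) ∧ Tendsto n atTop atTop ∧
        (lam 0 1 = 0 ∨
          (d 0 : ℝ) < -(Real.log (lam 0 1 ^ 2) / Real.log (∑' i, lam 0 i ^ 2)))) ∨
      -- `n, d → ∞`
      (Tendsto n atTop atTop ∧ Tendsto d atTop atTop ∧
        ∃ ε : ℝ, 0 < ε ∧ ∀ᶠ k in atTop,
          eigenvalueSum (lam k) < ENNReal.ofReal ((1 - ε) / d k)) ∨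
      -- `n` is constant and `d → ∞`
      ((∀ k, n k = n 0) ∧ Tendsto d atTop atTop ∧
        ∃ C : ℝ, ∀ᶠ k in atTop, eigenvalueSum (lam k) ≤ ENNReal.ofReal (C / d k))) :
    (∃ C : ℝ≥0, ∀ k, (D k).secondMoment (n k) (d k) ≤ C) ∧ ¬ AdmissibleStrong D d n := by
  suffices hbdd : ∃ C : ℝ≥0, ∀ k, (D k).secondMoment (n k) (d k) ≤ C from
    ⟨hbdd, not_admissibleStrong_of_secondMoment_le D d n hbdd.choose_spec⟩
  -- the bound holds from some `k` on, and the finitely many remaining second moments are finite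
  have hlarge : ∀ C : ℝ, Tendsto d atTop atTop →
      (∀ᶠ k in atTop, eigenvalueSum (lam k) ≤ ENNReal.ofReal (C / d k)) →
      ∃ C : ℝ≥0, ∀ k, (D k).secondMoment (n k) (d k) ≤ C := by
    intro C hd hC
    refine exists_bound_of_eventually_le
      (fun k => (D k).secondMoment_lt_top (n k) (d k) (hlam k))
      (B := ENNReal.ofReal (Real.exp (Real.exp |C| * (1 + |C|)))) ENNReal.ofReal_ne_top ?_
    filter_upwards [hd.eventually_ge_atTop 1, hC] with k hk1 hk2
    refine (D k).secondMoment_le_of_eigenvalueSum_le _ _ (hlam k) hk1 (abs_nonneg C)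
      (hk2.trans (ENNReal.ofReal_le_ofReal ?_))
    gcongr
    exact le_abs_self C
  rcases h with ⟨hd, hl, -, hthr⟩ | ⟨-, hd, ε, -, hε⟩ | ⟨-, hd, C, hC⟩
  · have hcond : lam 0 1 ^ 2 < 1 ∧ Summable fun i => lam 0 i ^ 2 := by
      rcases hthr with h0 | h0
      · exact ⟨by rw [h0]; norm_num, ((D 0).exists_likelihood_eigenexpansion (hlam 0)).1⟩
      · exact sq_lt_one_and_summable_of_threshold h0
    have hS : Summable fun i => lam 0 (i + 1) ^ 2 := (summable_nat_add_iff 1).2 hcond.2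
    refine ⟨(Real.exp ((1 + ∑' i, lam 0 (i + 1) ^ 2) ^ d 0 / (1 - lam 0 1 ^ 2))).toNNReal,
      fun k => ?_⟩
    have h1 : lam k 1 = lam 0 1 := hl k 1 le_rfl
    have := (D k).secondMoment_le_exp (n k) (d k) (hlam k) (by rw [h1]; exact hcond.1)
      (S := ∑' i, lam 0 (i + 1) ^ 2) fun s => by
        rw [Finset.sum_congr rfl fun i _ => by rw [hl k (i + 1) (Nat.le_add_left 1 i)]]
        exact hS.sum_le_tsum s fun i _ => sq_nonneg _
    rw [h1, hd k] at this
    rwa [hd k]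
  · exact hlarge (1 - ε) hd (hε.mono fun k hk => hk.le)
  · exact hlarge C hd hC
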